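/- Let $k$ be a field, $C$ a $k$-coalgebra and $\mathcal M^C$ the category of right $C$-comodules; write $\mathrm{Com}_C(M,N)$ for the space of comodule maps $M\to N$. A comodule $M\in\mathcal M^C$ is *quasi-finite* if $\mathrm{Com}_C(Y,M)$ is finite dimensional for every finite dimensional $Y\in\mathcal M^C$. Then, for every $X\in\mathcal M^C$, there is a vector space $h_{-C}(M,X)$ with a comodule map $\eta_X:X\to h_{-C}(M,X)\otimes M$ (where $C$ coacts on the factor $M$) such that every comodule map $X\to W\otimes M$, with $W$ a vector space, is $(v\otimes 1)\eta_X$ for a unique linear map $v:h_{-C}(M,X)\to W$; that is, $h_{-C}(M,-)$ is left adjoint to $-\otimes M$. The *coendomorphism coalgebra* of $M$ is $e_{-C}(M)=h_{-C}(M,M)$, whose comultiplication $\Delta$ and counit $\varepsilon$ are determined, with $\theta=\eta_M$, by $(\Delta\otimes 1)\theta=(1\otimes\theta)\theta$ and $(\varepsilon\otimes 1)\theta=1_M$ (identifying $k\otimes M=M$). Two comodules $M,N\in\mathcal M^C$ are *similar* if $M\oplus P\cong N^{(m)}$ and $N\oplus Q\cong M^{(n)}$ for some $m,n\in\mathbb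 N$ and $P,Q\in\mathcal M^C$; $M$ is an *ingenerator* of $\mathcal M^C$ if $M\oplus P\cong C^{(m)}$ and $C\oplus Q\cong M^{(n)}$ for some $m,n\in\mathbb N$ and $P,Q\in\mathcal M^C$. Two $k$-coalgebras $D$ and $E$ are *strongly equivalent* if there are inverse ($k$-linear) equivalences of categories $F:\mathcal M^D\rightleftarrows\mathcal M^E:G$ such that $F(D)$ is an ingenerator of $\mathcal M^E$ and $G(E)$ is an ingenerator of $\mathcal M^D$. **Theorem.** Let $C$ be a coalgebra over a field $k$, and let $M$ and $N$ be quasi-finite right $C$-comodules. If $M$ and $N$ are similar, then the coendomorphism coalgebras $e_{-C}(M)$ and $e_{-C}(N)$ are strongly equivalent. -/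

import Mathlib

open CategoryTheory TensorProduct

universe u

/-- A right comodule over the coalgebra `C` over the field `k`. -/
structure Comod (k C : Type u) [Field k] [AddCommGroup C] [Module k C] [Coalgebra k C] where
  /-- the underlying vector space -/
  carrier : Type u
  [addCommGroup : AddCommGroup carrier]
  [module : Module k carrier]
  /-- the structure map `M → M ⊗ C` -/
  coact : carrier →ₗ[k] carrier ⊗[k] C
  coassoc : (TensorProduct.assoc k carrier C C).toLinearMap ∘ₗ coact.rTensor C ∘ₗ coact =
    (Coalgebra.comul (R := k) (A := C)).lTensor carrier ∘ₗ coact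
  counit : (TensorProduct.rid k carrier).toLinearMap ∘ₗ
    (Coalgebra.counit (R := k) (A := C)).lTensor carrier ∘ₗ coact = LinearMap.id

namespace Comod

attribute [instance] Comod.addCommGroup Comod.module

section

variable {k C : Type u} [Field k] [AddCommGroup C] [Module k C] [Coalgebra k C]

instance : CoeSort (Comod k C) (Type u) := ⟨Comod.carrier⟩

/-- The space `Com_C(M, N)` of comodule maps from `M` to `N`. -/
def com (M N : Comod k C) : Submodule k (M →ₗ[k] N) where
  carrier := {f | f.rTensor C ∘ₗ M.coact = N.coact ∘ₗ f}
  add_mem' {f g} hf hg := by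
    simp only [Set.mem_ofPred_eq] at hf hg ⊢
    rw [LinearMap.rTensor_add, LinearMap.add_comp, hf, hg, LinearMap.comp_add]
  zero_mem' := by simp
  smul_mem' a f hf := by
    simp only [Set.mem_ofPred_eq] at hf ⊢
    rw [LinearMap.rTensor_smul, LinearMap.smul_comp, hf, LinearMap.comp_smul]

theorem com_apply {M N : Comod k C} (f : com M N) (x : M) :
    f.1.rTensor C (M.coact x) = N.coact (f.1 x) :=
  LinearMap.congr_fun f.2 x

theorem comp_mem_com {L M N : Comod k C} (f : com L M) (g : com M N) :
    g.1 ∘ₗ f.1 ∈ com L N := by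
  change (g.1 ∘ₗ f.1).rTensor C ∘ₗ L.coact = N.coact ∘ₗ (g.1 ∘ₗ f.1)
  ext x
  simp [LinearMap.rTensor_comp, com_apply]

/-- The category of right `C`-comodules; the morphisms are the comodule maps. -/
instance : Category (Comod k C) where
  Hom M N := com M N
  id M := ⟨LinearMap.id, by simp [com]⟩
  comp f g := ⟨g.1 ∘ₗ f.1, comp_mem_com f g⟩

instance : Preadditive (Comod k C) where
  homGroup M N := inferInstanceAs (AddCommGroup (com M N))
  add_comp _ _ _ f f' g := Subtype.ext (LinearMap.comp_add f.1 f'.1 g.1)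
  comp_add _ _ _ f g g' := Subtype.ext (LinearMap.add_comp f.1 g'.1 g.1)

instance : CategoryTheory.Linear k (Comod k C) where
  homModule M N := inferInstanceAs (Module k (com M N))
  smul_comp _ _ _ r f g := Subtype.ext (LinearMap.ext fun x => g.1.map_smul r (f.1 x))
  comp_smul _ _ _ _ _ _ := rfl

theorem coassoc_nat {V W : Type u} [AddCommGroup V] [Module k V] [AddCommGroup W] [Module k W]
    {c : V →ₗ[k] V ⊗[k] C} {ρ : W →ₗ[k] W ⊗[k] C} {j : W →ₗ[k] V}
    (h : c ∘ₗ j = j.rTensor C ∘ₗ ρ) :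
    ((TensorProduct.assoc k V C C).toLinearMap ∘ₗ c.rTensor C ∘ₗ c) ∘ₗ j =
      j.rTensor (C ⊗[k] C) ∘ₗ (TensorProduct.assoc k W C C).toLinearMap ∘ₗ ρ.rTensor C ∘ₗ ρ := by
  have h1 : ∀ s : (W ⊗[k] C) ⊗[k] C, TensorProduct.assoc k V C C ((j.rTensor C).rTensor C s) =
      j.rTensor (C ⊗[k] C) (TensorProduct.assoc k W C C s) := fun s =>
    LinearMap.congr_fun (f := (TensorProduct.assoc k V C C).toLinearMap ∘ₗ
      (j.rTensor C).rTensor C) (g := j.rTensor (C ⊗[k] C) ∘ₗ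
      (TensorProduct.assoc k W C C).toLinearMap) (by ext; simp) s
  have h2 : ∀ x, c (j x) = j.rTensor C (ρ x) := LinearMap.congr_fun h
  ext x
  simp only [LinearMap.comp_apply, LinearEquiv.coe_coe]
  rw [h2, ← LinearMap.rTensor_comp_apply, h, LinearMap.rTensor_comp_apply, h1]

theorem comul_nat {V W : Type u} [AddCommGroup V] [Module k V] [AddCommGroup W] [Module k W]
    {c : V →ₗ[k] V ⊗[k] C} {ρ : W →ₗ[k] W ⊗[k] C} {j : W →ₗ[k] V}
    (h : c ∘ₗ j = j.rTensor C ∘ₗ ρ) :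
    ((Coalgebra.comul (R := k) (A := C)).lTensor V ∘ₗ c) ∘ₗ j =
      j.rTensor (C ⊗[k] C) ∘ₗ (Coalgebra.comul (R := k) (A := C)).lTensor W ∘ₗ ρ := by
  rw [LinearMap.comp_assoc, h, ← LinearMap.comp_assoc, LinearMap.lTensor_comp_rTensor,
    ← LinearMap.comp_assoc, LinearMap.rTensor_comp_lTensor]

theorem counit_nat {V W : Type u} [AddCommGroup V] [Module k V] [AddCommGroup W] [Module k W]
    {c : V →ₗ[k] V ⊗[k] C} {ρ : W →ₗ[k] W ⊗[k] C} {j : W →ₗ[k] V}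
    (h : c ∘ₗ j = j.rTensor C ∘ₗ ρ) :
    ((TensorProduct.rid k V).toLinearMap ∘ₗ
      (Coalgebra.counit (R := k) (A := C)).lTensor V ∘ₗ c) ∘ₗ j =
    j ∘ₗ (TensorProduct.rid k W).toLinearMap ∘ₗ
      (Coalgebra.counit (R := k) (A := C)).lTensor W ∘ₗ ρ := by
  have h1 : (TensorProduct.rid k V).toLinearMap ∘ₗ
      (Coalgebra.counit (R := k) (A := C)).lTensor V ∘ₗ j.rTensor C =
      j ∘ₗ (TensorProduct.rid k W).toLinearMap ∘ₗ
        (Coalgebra.counit (R := k) (A := C)).lTensor W := by ext; simp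
  rw [LinearMap.comp_assoc, LinearMap.comp_assoc, h]
  exact congrArg (· ∘ₗ ρ) h1

theorem coassoc_comp {V : Type u} [AddCommGroup V] [Module k V] (c : V →ₗ[k] V ⊗[k] C)
    (N : Comod k C) (j : N →ₗ[k] V) (h : c ∘ₗ j = j.rTensor C ∘ₗ N.coact) :
    ((TensorProduct.assoc k V C C).toLinearMap ∘ₗ c.rTensor C ∘ₗ c) ∘ₗ j =
      ((Coalgebra.comul (R := k) (A := C)).lTensor V ∘ₗ c) ∘ₗ j := by
  rw [coassoc_nat h, comul_nat h, N.coassoc]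

theorem counit_comp {V : Type u} [AddCommGroup V] [Module k V] (c : V →ₗ[k] V ⊗[k] C)
    (N : Comod k C) (j : N →ₗ[k] V) (h : c ∘ₗ j = j.rTensor C ∘ₗ N.coact) :
    ((TensorProduct.rid k V).toLinearMap ∘ₗ
      (Coalgebra.counit (R := k) (A := C)).lTensor V ∘ₗ c) ∘ₗ j = j := by
  rw [counit_nat h, N.counit, LinearMap.comp_id]

theorem directSum_coact {ι : Type} [Fintype ι] [DecidableEq ι] (N : ι → Comod k C) (i : ι) :
    (∑ i, (LinearMap.single k (fun i => (N i : Type u)) i).rTensor C ∘ₗ (N i).coact ∘ₗ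
      LinearMap.proj i) ∘ₗ LinearMap.single k (fun i => (N i : Type u)) i =
    (LinearMap.single k (fun i => (N i : Type u)) i).rTensor C ∘ₗ (N i).coact := by
  refine LinearMap.ext fun x => ?_
  rw [LinearMap.comp_apply, LinearMap.sum_apply, Finset.sum_eq_single i]
  · simp
  · intro j _ hj
    simp [Pi.single_eq_of_ne hj]
  · simp

/-- The direct sum of the finite family `N i` of comodules, with coaction
`x ↦ ∑ i, (ι_i ⊗ 1) (ρ (x i))`, where `ι_i` is the inclusion of the `i`-th summand. -/
def directSum {ι : Type} [Fintype ι] [DecidableEq ι] (N : ι → Comod k C) : Comod k C where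
  carrier := ∀ i, N i
  coact := ∑ i, (LinearMap.single k (fun i => (N i : Type u)) i).rTensor C ∘ₗ (N i).coact ∘ₗ
    LinearMap.proj i
  coassoc := LinearMap.pi_ext' fun i => coassoc_comp _ (N i) _ (directSum_coact N i)
  counit := LinearMap.pi_ext' fun i => counit_comp _ (N i) _ (directSum_coact N i)

/-- The direct sum `M ⊕ N` of two comodules. -/
def prod (M N : Comod k C) : Comod k C where
  carrier := M × N
  coact := (LinearMap.inl k M N).rTensor C ∘ₗ M.coact ∘ₗ LinearMap.fst k M N +
    (LinearMap.inr k M N).rTensor C ∘ₗ N.coact ∘ₗ LinearMap.snd k M N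
  coassoc := LinearMap.prod_ext (coassoc_comp _ M _ (by ext; simp))
    (coassoc_comp _ N _ (by ext; simp))
  counit := LinearMap.prod_ext (counit_comp _ M _ (by ext; simp))
    (counit_comp _ N _ (by ext; simp))

/-- The direct sum `M^(n)` of `n` copies of `M`. -/
def power (M : Comod k C) (n : ℕ) : Comod k C := directSum fun _ : Fin n => M

variable (k C) in
/-- `C` as a right comodule over itself. -/
def regular : Comod k C where
  carrier := C
  coact := Coalgebra.comul
  coassoc := Coalgebra.coassoc
  counit := by
    ext x
    simp

/-- `M` and `N` are similar: each is a direct summand of a finite direct sum of copies of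
the other. -/
def Similar (M N : Comod k C) : Prop :=
  ∃ (m n : ℕ) (P Q : Comod k C),
    Nonempty (M.prod P ≅ N.power m) ∧ Nonempty (N.prod Q ≅ M.power n)

/-- `M` is an ingenerator: `M ⊕ P ≅ C^(m)` and `C ⊕ Q ≅ M^(n)` for some `m`, `n`, `P`, `Q`. -/
def IsIngenerator (M : Comod k C) : Prop :=
  ∃ (m n : ℕ) (P Q : Comod k C),
    Nonempty (M.prod P ≅ (regular k C).power m) ∧ Nonempty ((regular k C).prod Q ≅ M.power n)

/-- `M` is quasi-finite: `Com_C(Y, M)` is finite dimensional for every finite dimensional `Y`. -/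
def QuasiFinite (M : Comod k C) : Prop :=
  ∀ Y : Comod k C, Module.Finite k Y → Module.Finite k (com Y M)

/-- `g` is a comodule map from `X` to the comodule `W ⊗ M`, whose coaction is `1 ⊗ ρ_M`. -/
def IsColinear (X M : Comod k C) {W : Type u} [AddCommGroup W] [Module k W]
    (g : X →ₗ[k] W ⊗[k] M) : Prop :=
  (TensorProduct.assoc k W M C).toLinearMap ∘ₗ g.rTensor C ∘ₗ X.coact = M.coact.lTensor W ∘ₗ g

/-- A co-hom space `h_{-C}(M, X)`: a vector space `H` with a comodule map `η : X → H ⊗ M` such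
that `v ↦ (v ⊗ 1) η` is a bijection from `Hom_k(H, W)` to the space of comodule maps
`X → W ⊗ M`, for every vector space `W`. It is the value at `X` of the left adjoint
of `- ⊗ M`, and `η` is the unit of that adjunction. -/
structure Cohom (M X : Comod k C) where
  /-- the underlying vector space -/
  carrier : Type u
  [addCommGroup : AddCommGroup carrier]
  [module : Module k carrier]
  /-- the unit of the adjunction -/
  η : X →ₗ[k] carrier ⊗[k] M
  isColinear : IsColinear X M η
  universal : ∀ (W : Type u) [AddCommGroup W] [Module k W] (g : X →ₗ[k] W ⊗[k] M),
    IsColinear X M g → ∃! v : carrier →ₗ[k] W, v.rTensor M ∘ₗ η = g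

attribute [instance] Cohom.addCommGroup Cohom.module

theorem colinear_apply {X M : Comod k C} {W : Type u} [AddCommGroup W] [Module k W]
    {g : X →ₗ[k] W ⊗[k] M} (hg : IsColinear X M g) (x : X) :
    TensorProduct.assoc k W M C (g.rTensor C (X.coact x)) = M.coact.lTensor W (g x) :=
  LinearMap.congr_fun hg x

theorem assoc_symm_rTensor {V W X Y : Type u} [AddCommGroup V] [Module k V] [AddCommGroup W]
    [Module k W] [AddCommGroup X] [Module k X] [AddCommGroup Y] [Module k Y] (u : V →ₗ[k] W)
    (t : V ⊗[k] (X ⊗[k] Y)) :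
    (u.rTensor X).rTensor Y ((TensorProduct.assoc k V X Y).symm t) =
      (TensorProduct.assoc k W X Y).symm (u.rTensor (X ⊗[k] Y) t) :=
  LinearMap.congr_fun (f := (u.rTensor X).rTensor Y ∘ₗ
    (TensorProduct.assoc k V X Y).symm.toLinearMap)
    (g := (TensorProduct.assoc k W X Y).symm.toLinearMap ∘ₗ u.rTensor (X ⊗[k] Y)) (by ext; simp) t

theorem assoc_symm_lTensor {V W X Y : Type u} [AddCommGroup V] [Module k V] [AddCommGroup W]
    [Module k W] [AddCommGroup X] [Module k X] [AddCommGroup Y] [Module k Y] (u : V →ₗ[k] W)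
    (t : X ⊗[k] (V ⊗[k] Y)) :
    (u.lTensor X).rTensor Y ((TensorProduct.assoc k X V Y).symm t) =
      (TensorProduct.assoc k X W Y).symm ((u.rTensor Y).lTensor X t) :=
  LinearMap.congr_fun (f := (u.lTensor X).rTensor Y ∘ₗ
    (TensorProduct.assoc k X V Y).symm.toLinearMap)
    (g := (TensorProduct.assoc k X W Y).symm.toLinearMap ∘ₗ (u.rTensor Y).lTensor X)
    (by ext; simp) t

theorem assoc_rTensor {V W X Y : Type u} [AddCommGroup V] [Module k V] [AddCommGroup W]
    [Module k W] [AddCommGroup X] [Module k X] [AddCommGroup Y] [Module k Y] (u : V →ₗ[k] W)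
    (t : (V ⊗[k] X) ⊗[k] Y) :
    TensorProduct.assoc k W X Y ((u.rTensor X).rTensor Y t) =
      u.rTensor (X ⊗[k] Y) (TensorProduct.assoc k V X Y t) :=
  LinearMap.congr_fun (f := (TensorProduct.assoc k W X Y).toLinearMap ∘ₗ (u.rTensor X).rTensor Y)
    (g := u.rTensor (X ⊗[k] Y) ∘ₗ (TensorProduct.assoc k V X Y).toLinearMap) (by ext; simp) t

theorem lTensor_rTensor_apply {V W X Y : Type u} [AddCommGroup V] [Module k V] [AddCommGroup W]
    [Module k W] [AddCommGroup X] [Module k X] [AddCommGroup Y] [Module k Y] (u : V →ₗ[k] W)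
    (f : X →ₗ[k] Y) (t : V ⊗[k] X) :
    f.lTensor W (u.rTensor X t) = u.rTensor Y (f.lTensor V t) := by
  rw [← LinearMap.comp_apply, LinearMap.lTensor_comp_rTensor, ← LinearMap.rTensor_comp_lTensor,
    LinearMap.comp_apply]

theorem IsColinear.comp {X M : Comod k C} {V W : Type u} [AddCommGroup V] [Module k V]
    [AddCommGroup W] [Module k W] {g : X →ₗ[k] V ⊗[k] M} (hg : IsColinear X M g)
    (u : V →ₗ[k] W) : IsColinear X M (u.rTensor M ∘ₗ g) := by
  refine LinearMap.ext fun x => ?_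
  simp only [LinearMap.comp_apply, LinearEquiv.coe_coe, LinearMap.rTensor_comp]
  rw [assoc_rTensor, colinear_apply hg, lTensor_rTensor_apply]

theorem Cohom.hom_ext {M X : Comod k C} (H : Cohom M X) {W : Type u} [AddCommGroup W]
    [Module k W] {v w : H.carrier →ₗ[k] W} (h : v.rTensor M ∘ₗ H.η = w.rTensor M ∘ₗ H.η) :
    v = w :=
  (H.universal W _ (H.isColinear.comp w)).unique h rfl

/-! ### Existence of the co-hom spaces of a quasi-finite comodule -/

/-- The slice map `x ⊗ d ↦ φ d • x`. -/
noncomputable def slice (X : Type u) {D : Type u} [AddCommGroup X] [Module k X] [AddCommGroup D]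
    [Module k D] (φ : D →ₗ[k] k) : X ⊗[k] D →ₗ[k] X :=
  (TensorProduct.rid k X).toLinearMap ∘ₗ φ.lTensor X

theorem slice_tmul {X D : Type u} [AddCommGroup X] [Module k X] [AddCommGroup D] [Module k D]
    (φ : D →ₗ[k] k) (x : X) (d : D) : slice X φ (x ⊗ₜ[k] d) = φ d • x := by
  simp [slice]

theorem slice_rTensor {X Y D : Type u} [AddCommGroup X] [Module k X] [AddCommGroup Y]
    [Module k Y] [AddCommGroup D] [Module k D] (φ : D →ₗ[k] k) (f : X →ₗ[k] Y)
    (t : X ⊗[k] D) : slice Y φ (f.rTensor D t) = f (slice X φ t) :=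
  LinearMap.congr_fun (f := slice Y φ ∘ₗ f.rTensor D) (g := f ∘ₗ slice X φ)
    (by ext; simp [slice_tmul]) t

theorem exists_slices {X D : Type u} [AddCommGroup X] [Module k X] [AddCommGroup D]
    [Module k D] (t : X ⊗[k] D) : ∃ (ι : Type u) (s : Finset ι) (φ : ι → D →ₗ[k] k) (d : ι → D),
    t = ∑ i ∈ s, slice X (φ i) t ⊗ₜ[k] d i := by
  classical
  let b := Module.Basis.ofVectorSpace k D
  have hc : ∀ i, Finsupp.lapply i ∘ₗ (TensorProduct.equivFinsuppOfBasisRight b).toLinearMap =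
      slice X (b.coord i) := by
    intro i
    ext x y
    simp [slice_tmul]
  refine ⟨_, (TensorProduct.equivFinsuppOfBasisRight b t).support, fun i => b.coord i, b, ?_⟩
  conv_lhs => rw [← (TensorProduct.equivFinsuppOfBasisRight b).symm_apply_apply t,
    TensorProduct.equivFinsuppOfBasisRight_symm_apply]
  refine Finset.sum_congr rfl fun i _ => ?_
  congr 1
  exact LinearMap.congr_fun (hc i) t

theorem mem_range_rTensor {X D : Type u} [AddCommGroup X] [Module k X] [AddCommGroup D]
    [Module k D] (L : Submodule k X) (t : X ⊗[k] D) (h : ∀ φ : D →ₗ[k] k, slice X φ t ∈ L) :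
    t ∈ LinearMap.range (L.subtype.rTensor D) := by
  obtain ⟨ι, s, φ, d, ht⟩ := exists_slices t
  rw [ht]
  exact Submodule.sum_mem _ fun i _ => ⟨⟨_, h (φ i)⟩ ⊗ₜ d i, by simp⟩

/-- The slice map `x ⊗ d ↦ φ x • d`. -/
noncomputable def lslice {X : Type u} (D : Type u) [AddCommGroup X] [Module k X] [AddCommGroup D]
    [Module k D] (φ : X →ₗ[k] k) : X ⊗[k] D →ₗ[k] D :=
  (TensorProduct.lid k D).toLinearMap ∘ₗ φ.rTensor D

theorem lslice_tmul {X D : Type u} [AddCommGroup X] [Module k X] [AddCommGroup D] [Module k D]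
    (φ : X →ₗ[k] k) (x : X) (d : D) : lslice D φ (x ⊗ₜ[k] d) = φ x • d := by
  simp [lslice]

theorem lslice_lTensor {X D E : Type u} [AddCommGroup X] [Module k X] [AddCommGroup D]
    [Module k D] [AddCommGroup E] [Module k E] (φ : X →ₗ[k] k) (f : D →ₗ[k] E)
    (t : X ⊗[k] D) : lslice E φ (f.lTensor X t) = f (lslice D φ t) :=
  LinearMap.congr_fun (f := lslice E φ ∘ₗ f.lTensor X) (g := f ∘ₗ lslice D φ)
    (by ext; simp [lslice_tmul]) t

theorem lslice_rTensor {X Y D : Type u} [AddCommGroup X] [Module k X] [AddCommGroup D]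
    [Module k D] [AddCommGroup Y] [Module k Y] (φ : Y →ₗ[k] k) (v : X →ₗ[k] Y)
    (t : X ⊗[k] D) : lslice D φ (v.rTensor D t) = lslice D (φ ∘ₗ v) t :=
  LinearMap.congr_fun (f := lslice D φ ∘ₗ v.rTensor D) (g := lslice D (φ ∘ₗ v))
    (by ext; simp [lslice_tmul]) t

theorem lslice_assoc {X D E : Type u} [AddCommGroup X] [Module k X] [AddCommGroup D]
    [Module k D] [AddCommGroup E] [Module k E] (φ : X →ₗ[k] k) (t : (X ⊗[k] D) ⊗[k] E) :
    lslice (D ⊗[k] E) φ (TensorProduct.assoc k X D E t) = (lslice D φ).rTensor E t :=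
  LinearMap.congr_fun (f := lslice (D ⊗[k] E) φ ∘ₗ (TensorProduct.assoc k X D E).toLinearMap)
    (g := (lslice D φ).rTensor E) (by ext; simp [lslice_tmul, smul_tmul']) t

theorem slice_lslice {X D : Type u} [AddCommGroup X] [Module k X] [AddCommGroup D]
    [Module k D] (φ : X →ₗ[k] k) (ψ : D →ₗ[k] k) (t : X ⊗[k] D) :
    φ (slice X ψ t) = ψ (lslice D φ t) :=
  LinearMap.congr_fun (f := φ ∘ₗ slice X ψ) (g := ψ ∘ₗ lslice D φ)
    (by ext; simp [lslice_tmul, slice_tmul, mul_comm]) t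

theorem eq_of_lslice {X D : Type u} [AddCommGroup X] [Module k X] [AddCommGroup D]
    [Module k D] {t t' : X ⊗[k] D} {I : Type u} (S : I → X →ₗ[k] k)
    (hS : ∀ x, (∀ i, S i x = 0) → x = 0) (h : ∀ i, lslice D (S i) t = lslice D (S i) t') :
    t = t' := by
  rw [← sub_eq_zero]
  obtain ⟨ι, s, φ, d, ht⟩ := exists_slices (t - t')
  rw [ht]
  refine Finset.sum_eq_zero fun i _ => ?_
  rw [hS (slice X (φ i) (t - t')) fun j => by
    rw [slice_lslice, map_sub, h j, sub_self, map_zero], zero_tmul]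

theorem lslice_mem_com {X M : Comod k C} {W : Type u} [AddCommGroup W] [Module k W]
    {g : X →ₗ[k] W ⊗[k] M} (hg : IsColinear X M g) (φ : W →ₗ[k] k) :
    lslice M φ ∘ₗ g ∈ com X M := by
  refine LinearMap.ext fun x => ?_
  rw [LinearMap.comp_apply, LinearMap.rTensor_comp_apply, ← lslice_assoc, colinear_apply hg,
    lslice_lTensor]
  rfl

theorem exists_finite (X : Comod k C) (x : X) : ∃ (Y : Comod k C) (f : com Y X) (y : Y),
    Module.Finite k Y ∧ f.1 y = x := by
  -- the coefficient space of `x`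
  let sl : (C →ₗ[k] k) →ₗ[k] X :=
    { toFun := fun φ => slice X φ (X.coact x)
      map_add' := fun φ ψ => by simp [slice, LinearMap.lTensor_add]
      map_smul' := fun a φ => by simp [slice, LinearMap.lTensor_smul] }
  let L : Submodule k X := LinearMap.range sl
  have hfin : Module.Finite k L := by
    obtain ⟨ι, s, φ, d, ht⟩ := exists_slices (X.coact x)
    classical
    refine Module.Finite.iff_fg.2 (Submodule.FG.of_le (T := Submodule.span k
      (Finset.image (fun i => slice X (φ i) (X.coact x)) s)) ⟨_, rfl⟩ ?_)
    rintro _ ⟨ψ, rfl⟩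
    change slice X ψ (X.coact x) ∈ _
    rw [ht, map_sum]
    refine Submodule.sum_mem _ fun i hi => ?_
    rw [slice_tmul, ← ht]
    refine Submodule.smul_mem _ _ (Submodule.subset_span ?_)
    simpa using ⟨i, hi, rfl⟩
  have hx : x ∈ L := ⟨Coalgebra.counit, LinearMap.congr_fun X.counit x⟩
  have hinj : ∀ D : Type u, ∀ [AddCommGroup D] [Module k D],
      Function.Injective (L.subtype.rTensor D) := fun D _ _ =>
    Module.Flat.rTensor_preserves_injective_linearMap _ L.injective_subtype
  have hmem : ∀ y : L, X.coact y ∈ LinearMap.range (L.subtype.rTensor C) := by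
    rintro ⟨_, ψ, rfl⟩
    refine mem_range_rTensor L _ fun φ => ?_
    refine ⟨(TensorProduct.lid k k).toLinearMap ∘ₗ TensorProduct.map φ ψ ∘ₗ Coalgebra.comul, ?_⟩
    have h1 : slice X ((TensorProduct.lid k k).toLinearMap ∘ₗ TensorProduct.map φ ψ) ∘ₗ
        (TensorProduct.assoc k X C C).toLinearMap = slice X φ ∘ₗ slice (X ⊗[k] C) ψ := by
      ext; simp [slice_tmul, smul_smul, mul_comm]
    change slice X _ (X.coact x) = slice X φ (X.coact (slice X ψ (X.coact x)))
    rw [← slice_rTensor, ← LinearMap.comp_apply (slice X φ), ← h1]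
    have h2 := LinearMap.congr_fun X.coassoc x
    simp only [LinearMap.comp_apply, LinearEquiv.coe_coe] at h2 ⊢
    rw [h2]
    simp [slice, LinearMap.lTensor_comp]
  let ρ : L →ₗ[k] L ⊗[k] C :=
    (LinearEquiv.ofInjective _ (hinj C)).symm.toLinearMap ∘ₗ
      (X.coact ∘ₗ L.subtype).codRestrict _ hmem
  have hρ : ∀ y : L, L.subtype.rTensor C (ρ y) = X.coact y := fun y =>
    congrArg Subtype.val ((LinearEquiv.ofInjective _ (hinj C)).apply_symm_apply
      ((X.coact ∘ₗ L.subtype).codRestrict _ hmem y))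
  have hj : X.coact ∘ₗ L.subtype = L.subtype.rTensor C ∘ₗ ρ :=
    LinearMap.ext fun y => (hρ y).symm
  let Y : Comod k C :=
    { carrier := L
      coact := ρ
      coassoc := by
        refine LinearMap.ext fun y => hinj (C ⊗[k] C) ?_
        have h1 := LinearMap.congr_fun (coassoc_nat hj) y
        have h2 := LinearMap.congr_fun (comul_nat hj) y
        rw [X.coassoc] at h1
        exact h1.symm.trans h2
      counit := by
        refine LinearMap.ext fun y => L.injective_subtype ?_
        have h1 := LinearMap.congr_fun (counit_nat hj) y
        rw [X.counit] at h1
        exact h1.symm }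
  exact ⟨Y, ⟨L.subtype, LinearMap.ext hρ⟩, ⟨x, hx⟩, hfin, rfl⟩

theorem finite_eval {M : Comod k C} (hM : M.QuasiFinite) (X : Comod k C) (x : X) :
    Module.Finite k (LinearMap.range ((LinearMap.applyₗ x).comp (com X M).subtype)) := by
  obtain ⟨Y, f, y, hY, rfl⟩ := exists_finite X x
  have := hM Y hY
  let r : com X M →ₗ[k] com Y M :=
    { toFun := fun g => ⟨g.1 ∘ₗ f.1, comp_mem_com f g⟩
      map_add' := fun _ _ => rfl
      map_smul' := fun _ _ => rfl }
  refine Module.Finite.iff_fg.2 (Submodule.FG.of_le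
    (T := LinearMap.range ((LinearMap.applyₗ y).comp (com Y M).subtype))
    (Module.Finite.iff_fg.1 inferInstance) ?_)
  rintro _ ⟨g, rfl⟩
  exact ⟨r g, rfl⟩

/-- The functional `f ↦ m (f x)` on `Com_C(X, M)`. -/
def matrixCoeff {M X : Comod k C} (x : X) (m : M →ₗ[k] k) : com X M →ₗ[k] k where
  toFun f := m (f.1 x)
  map_add' f g := by simp
  map_smul' a f := by simp

/-- The span of the functionals `f ↦ m (f x)` on `Com_C(X, M)`, where `x ∈ X` and `m ∈ M^*`. -/
def coeff (M X : Comod k C) : Submodule k (com X M →ₗ[k] k) :=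
  Submodule.span k {φ | ∃ (x : X) (m : M →ₗ[k] k), matrixCoeff x m = φ}

/-- The vector space underlying `coeff M X`. -/
def Coeff (M X : Comod k C) : Type u := coeff M X

instance (M X : Comod k C) : AddCommGroup (Coeff M X) := inferInstanceAs (AddCommGroup (coeff M X))

instance (M X : Comod k C) : Module k (Coeff M X) := inferInstanceAs (Module k (coeff M X))

/-- Evaluation at `f`. -/
def ev {M X : Comod k C} (f : com X M) : Coeff M X →ₗ[k] k where
  toFun φ := φ.1 f
  map_add' _ _ := rfl
  map_smul' _ _ := rfl

theorem ev_ext {M X : Comod k C} {φ ψ : Coeff M X} (h : ∀ f, ev f φ = ev f ψ) : φ = ψ :=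
  Subtype.ext (LinearMap.ext h)

/-- The functional `f ↦ m (f x)` as an element of `Coeff M X`. -/
def Coeff.mk {M X : Comod k C} (x : X) (m : M →ₗ[k] k) : Coeff M X :=
  ⟨matrixCoeff x m, Submodule.subset_span ⟨_, _, rfl⟩⟩

theorem ev_mk {M X : Comod k C} (f : com X M) (x : X) (m : M →ₗ[k] k) :
    ev f (Coeff.mk x m) = m (f.1 x) := rfl

theorem Coeff.induction {M X : Comod k C} {p : Coeff M X → Prop} (mk : ∀ x m, p (Coeff.mk x m))
    (zero : p 0) (add : ∀ φ ψ, p φ → p ψ → p (φ + ψ)) (smul : ∀ (a : k) φ, p φ → p (a • φ))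
    (φ : Coeff M X) : p φ := by
  obtain ⟨φ, hφ⟩ := φ
  exact Submodule.span_induction (p := fun φ (hφ : φ ∈ coeff M X) => p ⟨φ, hφ⟩)
    (fun _ ⟨x, m, h⟩ => by subst h; exact mk x m) zero (fun _ _ _ _ h1 h2 => add _ _ h1 h2)
    (fun a _ _ h => smul a _ h) hφ

theorem eq_of_ev {M X : Comod k C} {D : Type u} [AddCommGroup D] [Module k D]
    {t t' : Coeff M X ⊗[k] D} (h : ∀ f, lslice D (ev f) t = lslice D (ev f) t') : t = t' :=
  eq_of_lslice ev (fun _ hx => ev_ext fun f => by rw [hx, map_zero]) h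

theorem exists_unit {M : Comod k C} (hM : M.QuasiFinite) (X : Comod k C) (x : X) :
    ∃ t : Coeff M X ⊗[k] M, ∀ f, lslice M (ev f) t = f.1 x := by
  have := finite_eval hM X x
  set V := LinearMap.range ((LinearMap.applyₗ x).comp (com X M).subtype) with hV
  obtain ⟨π, hπ⟩ := V.subtype.exists_leftInverse_of_injective V.ker_subtype
  let b := Module.finBasis k V
  refine ⟨∑ i, Coeff.mk x (b.coord i ∘ₗ π) ⊗ₜ[k] (b i : M), fun f => ?_⟩
  have hv : f.1 x ∈ V := ⟨f, rfl⟩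
  have hπ' : π (f.1 x) = ⟨f.1 x, hv⟩ := LinearMap.congr_fun hπ ⟨f.1 x, hv⟩
  have h1 := congrArg Subtype.val (b.sum_repr ⟨f.1 x, hv⟩)
  rw [map_sum]
  simp only [lslice_tmul, ev_mk]
  rw [AddSubmonoidClass.coe_finsetSum] at h1
  refine Eq.trans (Finset.sum_congr rfl fun i _ => ?_) h1
  change b.coord i (π (f.1 x)) • _ = _
  rw [hπ']
  rfl

theorem nonempty_cohom {M : Comod k C} (hM : M.QuasiFinite) (X : Comod k C) :
    Nonempty (Cohom M X) := by
  choose t ht using exists_unit hM X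
  let η : X →ₗ[k] Coeff M X ⊗[k] M :=
    { toFun := t
      map_add' := fun x y => eq_of_ev fun f => by simp [ht]
      map_smul' := fun a x => eq_of_ev fun f => by simp [ht] }
  have hη : ∀ f x, lslice M (ev f) (η x) = f.1 x := fun f x => ht x f
  refine ⟨{ carrier := Coeff M X, η := η, isColinear := ?_, universal := ?_ }⟩
  · refine LinearMap.ext fun x => eq_of_ev fun f => ?_
    simp only [LinearMap.comp_apply, LinearEquiv.coe_coe]
    rw [lslice_assoc, lslice_lTensor, hη, ← LinearMap.rTensor_comp_apply,
      show lslice M (ev f) ∘ₗ η = f.1 from LinearMap.ext (hη f), com_apply]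
  · intro W _ _ g hg
    have hsl : ∀ x m, slice (Coeff M X) m (η x) = Coeff.mk x m := fun x m =>
      ev_ext fun f => by rw [slice_lslice, hη, ev_mk]
    let F : (W →ₗ[k] k) → com X M := fun w => ⟨lslice M w ∘ₗ g, lslice_mem_com hg w⟩
    have key : ∀ φ : Coeff M X, ∃ y : W, ∀ w : W →ₗ[k] k, w y = ev (F w) φ := by
      refine Coeff.induction ?_ ?_ ?_ ?_
      · exact fun x m => ⟨slice W m (g x), fun w => slice_lslice w m (g x)⟩
      · exact ⟨0, fun w => by simp⟩
      · rintro φ ψ ⟨y, hy⟩ ⟨z, hz⟩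
        exact ⟨y + z, fun w => by simp [hy, hz]⟩
      · rintro a φ ⟨y, hy⟩
        exact ⟨a • y, fun w => by simp [hy]⟩
    choose y hy using key
    have hsep : ∀ z : W, (∀ w : W →ₗ[k] k, w z = 0) → z = 0 := fun z =>
      (Module.forall_dual_apply_eq_zero_iff k z).1
    have hsep' : ∀ z z' : W, (∀ w : W →ₗ[k] k, w z = w z') → z = z' := fun z z' h =>
      sub_eq_zero.1 (hsep _ fun w => by rw [map_sub, h, sub_self])
    let v : Coeff M X →ₗ[k] W :=
      { toFun := y
        map_add' := fun φ ψ => hsep' _ _ fun w => by simp [hy]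
        map_smul' := fun a φ => hsep' _ _ fun w => by simp [hy] }
    refine ⟨v, LinearMap.ext fun x => eq_of_lslice (fun w : W →ₗ[k] k => w) hsep fun w => ?_, ?_⟩
    · rw [LinearMap.comp_apply, lslice_rTensor,
        show w ∘ₗ v = ev (F w) from LinearMap.ext fun φ => hy φ w, hη]
      rfl
    · intro v' hv'
      refine LinearMap.ext (Coeff.induction ?_ ?_ ?_ ?_)
      · intro x m
        refine hsep' _ _ fun w => ?_
        rw [show w (v (Coeff.mk x m)) = ev (F w) (Coeff.mk x m) from hy _ w, ev_mk, ← hsl,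
          ← slice_rTensor, ← LinearMap.comp_apply (v'.rTensor M), hv', slice_lslice]
        rfl
      · rw [map_zero, map_zero]
      · intro φ ψ h1 h2
        rw [map_add, map_add, h1, h2]
      · intro a φ h
        rw [map_smul, map_smul, h]

/-- The co-hom space `h_{-C}(M, X)` of the quasi-finite comodule `M`. -/
noncomputable def cohom {M : Comod k C} (hM : M.QuasiFinite) (X : Comod k C) : Cohom M X :=
  Classical.choice (nonempty_cohom hM X)

/-! ### The coendomorphism coalgebra -/

theorem IsColinear.trans {X Y Z : Comod k C} {V W : Type u} [AddCommGroup V] [Module k V]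
    [AddCommGroup W] [Module k W] {f : X →ₗ[k] V ⊗[k] Y} (hf : IsColinear X Y f)
    {g : Y →ₗ[k] W ⊗[k] Z} (hg : IsColinear Y Z g) :
    IsColinear X Z ((TensorProduct.assoc k V W Z).symm.toLinearMap ∘ₗ g.lTensor V ∘ₗ f) := by
  have h1 : (TensorProduct.assoc k (V ⊗[k] W) Z C).toLinearMap ∘ₗ
      ((TensorProduct.assoc k V W Z).symm.toLinearMap ∘ₗ g.lTensor V).rTensor C =
      (TensorProduct.assoc k V W (Z ⊗[k] C)).symm.toLinearMap ∘ₗ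
        ((TensorProduct.assoc k W Z C).toLinearMap ∘ₗ g.rTensor C).lTensor V ∘ₗ
        (TensorProduct.assoc k V Y C).toLinearMap := by
    ext v y c
    simp only [TensorProduct.AlgebraTensorModule.curry_apply, LinearMap.restrictScalars_self,
      TensorProduct.curry_apply, LinearMap.comp_apply, LinearEquiv.coe_coe,
      LinearMap.rTensor_tmul, LinearMap.lTensor_tmul, TensorProduct.assoc_tmul]
    induction g y using TensorProduct.induction_on with
    | zero => simp
    | tmul w z => simp
    | add s t hs ht => simp only [tmul_add, add_tmul, map_add, hs, ht]
  have h2 : (TensorProduct.assoc k V W (Z ⊗[k] C)).symm.toLinearMap ∘ₗ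
      (Z.coact.lTensor W).lTensor V =
      Z.coact.lTensor (V ⊗[k] W) ∘ₗ (TensorProduct.assoc k V W Z).symm.toLinearMap := by
    ext; simp
  change _ ∘ₗ (((TensorProduct.assoc k V W Z).symm.toLinearMap ∘ₗ g.lTensor V) ∘ₗ f).rTensor C ∘ₗ
    _ = _
  rw [LinearMap.rTensor_comp, LinearMap.comp_assoc, ← LinearMap.comp_assoc, h1,
    LinearMap.comp_assoc, LinearMap.comp_assoc, hf, ← LinearMap.comp_assoc f,
    ← LinearMap.lTensor_comp, LinearMap.comp_assoc, hg, LinearMap.lTensor_comp,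
    ← LinearMap.comp_assoc, ← LinearMap.comp_assoc, h2]
  rfl

theorem isColinear_one {X Y : Comod k C} (f : com X Y) :
    IsColinear X Y (TensorProduct.mk k k Y 1 ∘ₗ f.1) := by
  refine LinearMap.ext fun x => ?_
  simp only [LinearMap.comp_apply, LinearMap.rTensor_comp_apply, com_apply]
  have h1 : (TensorProduct.assoc k k Y C).toLinearMap ∘ₗ (TensorProduct.mk k k Y 1).rTensor C =
      TensorProduct.mk k k (Y ⊗[k] C) 1 := by ext; simp
  exact LinearMap.congr_fun h1 _

section

variable {M : Comod k C} (H : Cohom M M)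

/-- The comultiplication of `h_{-C}(M, M)`: the unique linear map `Δ` with
`(Δ ⊗ 1) θ = (1 ⊗ θ) θ`, where `θ : M → h_{-C}(M, M) ⊗ M` is the unit of the adjunction. -/
noncomputable def Cohom.comul : H.carrier →ₗ[k] H.carrier ⊗[k] H.carrier :=
  (H.universal _ _ (H.isColinear.trans H.isColinear)).choose

theorem Cohom.comul_spec : H.comul.rTensor M ∘ₗ H.η =
    (TensorProduct.assoc k H.carrier H.carrier M).symm.toLinearMap ∘ₗ
      H.η.lTensor H.carrier ∘ₗ H.η :=
  (H.universal _ _ (H.isColinear.trans H.isColinear)).choose_spec.1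

theorem Cohom.comul_apply (m : M) : H.comul.rTensor M (H.η m) =
    (TensorProduct.assoc k H.carrier H.carrier M).symm (H.η.lTensor H.carrier (H.η m)) :=
  LinearMap.congr_fun H.comul_spec m

/-- The counit of `h_{-C}(M, M)`: the unique linear map `ε` with `(ε ⊗ 1) θ = 1`. -/
noncomputable def Cohom.counit : H.carrier →ₗ[k] k :=
  (H.universal _ _ (isColinear_one (𝟙 M : M ⟶ M))).choose

theorem Cohom.counit_spec : H.counit.rTensor M ∘ₗ H.η = TensorProduct.mk k k M 1 :=
  (H.universal _ _ (isColinear_one (𝟙 M : M ⟶ M))).choose_spec.1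

theorem Cohom.counit_apply (m : M) : H.counit.rTensor M (H.η m) = 1 ⊗ₜ[k] m :=
  LinearMap.congr_fun H.counit_spec m

/-- The coalgebra structure of `h_{-C}(M, M)`. -/
@[reducible]
noncomputable def Cohom.coalgebra : Coalgebra k H.carrier where
  comul := H.comul
  counit := H.counit
  coassoc := by
    have h1 : ((TensorProduct.assoc k H.carrier H.carrier H.carrier).toLinearMap).rTensor M ∘ₗ
        (TensorProduct.assoc k (H.carrier ⊗[k] H.carrier) H.carrier M).symm.toLinearMap ∘ₗ
        H.η.lTensor (H.carrier ⊗[k] H.carrier) ∘ₗ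
        (TensorProduct.assoc k H.carrier H.carrier M).symm.toLinearMap =
        (TensorProduct.assoc k H.carrier (H.carrier ⊗[k] H.carrier) M).symm.toLinearMap ∘ₗ
        ((TensorProduct.assoc k H.carrier H.carrier M).symm.toLinearMap ∘ₗ
          H.η.lTensor H.carrier).lTensor H.carrier := by
      ext a b m
      simp only [TensorProduct.AlgebraTensorModule.curry_apply, LinearMap.restrictScalars_self,
        TensorProduct.curry_apply, LinearMap.comp_apply, LinearEquiv.coe_coe,
        LinearMap.lTensor_tmul, TensorProduct.assoc_symm_tmul]
      induction H.η m using TensorProduct.induction_on with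
      | zero => simp
      | tmul w z => simp
      | add s t hs ht => simp only [tmul_add, map_add, hs, ht]
    refine H.hom_ext (LinearMap.ext fun m => ?_)
    have h2 := LinearMap.congr_fun h1 (H.η.lTensor H.carrier (H.η m))
    simp only [LinearMap.comp_apply, LinearEquiv.coe_coe, LinearMap.rTensor_comp_apply,
      H.comul_apply, assoc_symm_rTensor, assoc_symm_lTensor] at h2 ⊢
    rw [← lTensor_rTensor_apply, H.comul_apply, h2, ← LinearMap.lTensor_comp_apply,
      ← LinearMap.lTensor_comp_apply, H.comul_spec]
    rfl
  rTensor_counit_comp_comul := by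
    refine H.hom_ext (LinearMap.ext fun m => ?_)
    simp only [LinearMap.comp_apply, LinearMap.rTensor_comp_apply, H.comul_apply,
      assoc_symm_rTensor]
    rw [← lTensor_rTensor_apply, H.counit_apply, LinearMap.lTensor_tmul]
    induction H.η m using TensorProduct.induction_on with
    | zero => simp
    | tmul w z => simp
    | add s t hs ht => simp only [tmul_add, map_add, hs, ht]
  lTensor_counit_comp_comul := by
    refine H.hom_ext (LinearMap.ext fun m => ?_)
    simp only [LinearMap.comp_apply, LinearMap.rTensor_comp_apply, H.comul_apply,
      assoc_symm_lTensor]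
    rw [← LinearMap.lTensor_comp_apply, H.counit_spec]
    exact LinearMap.congr_fun (f := (TensorProduct.assoc k H.carrier k M).symm.toLinearMap ∘ₗ
      (TensorProduct.mk k k M 1).lTensor H.carrier)
      (g := ((TensorProduct.mk k H.carrier k).flip 1).rTensor M) (by ext; simp) _

end

/-- The underlying space of the coendomorphism coalgebra `e_{-C}(M) = h_{-C}(M, M)`. -/
def Coend {M : Comod k C} (hM : M.QuasiFinite) : Type u := (cohom hM M).carrier

noncomputable instance {M : Comod k C} (hM : M.QuasiFinite) : AddCommGroup (Coend hM) :=
  (cohom hM M).addCommGroup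

noncomputable instance {M : Comod k C} (hM : M.QuasiFinite) : Module k (Coend hM) :=
  (cohom hM M).module

noncomputable instance {M : Comod k C} (hM : M.QuasiFinite) : Coalgebra k (Coend hM) :=
  (cohom hM M).coalgebra

end

/-- The coalgebras `D` and `E` are strongly equivalent: there are mutually inverse `k`-linear
equivalences between their categories of right comodules which send `D` to an ingenerator of
`M^E` and `E` to an ingenerator of `M^D`. -/
def StronglyEquivalent (k D E : Type u) [Field k] [AddCommGroup D] [Module k D] [Coalgebra k D]
    [AddCommGroup E] [Module k E] [Coalgebra k E] : Prop :=
  ∃ F : Comod k D ≌ Comod k E, F.functor.Additive ∧ F.functor.Linear k ∧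
    IsIngenerator (F.functor.obj (regular k D)) ∧ IsIngenerator (F.inverse.obj (regular k E))

end Comod

/-!
# Coendomorphism coalgebras of similar quasi-finite comodules

The co-hom spaces `hom M N = h(N, M)` of quasi-finite comodules carry comultiplications
`hom M L → hom M N ⊗ hom N L`, dual to composition, and so form a `k`-linear *cocategory*: the dual
of a category (`Comod.cohomCocategory`). The coalgebra `e(M)` is the space `hom M M`. A comodule
map `f : M → N` is a functional `ev f` on `hom M N`, and `(ev f ⊗ ev g) Δ = ev (f ≫ g)`
(`Comod.Cohom.eval_comp`). If `M` is a direct summand of `N^m`, then `1_M = ∑ s_a ≫ r_a` with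
`s_a : M → N` and `r_a : N → M`, so the counit of `e(M)` is `∑ (ev s_a ⊗ ev r_a) Δ`. This is
`Cocategory.IsRetract`, and it is all that the rest of the argument uses.

In any cocategory, take a functional `τ` on `hom i j ⊗ hom j i` with `τ Δ = ε_i`. For a right
`hom i i`-comodule `X` with coaction `ρ`, the maps `(1 ⊗ Δ) ρ` and `1 ⊗ τ` are then mutually inverse
between `X` and `(X □ hom i j) □ hom j i`. One composite is the identity because `τ Δ = ε_i`; for
the other (`Cocategory.expand_slice`), the two cotensor conditions move all comultiplications to the
last factor, where `τ Δ = ε_i` applies again. With such functionals for `(i, j)` and for `(j, i)`,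
the cotensor functors `- □ hom i j` and `- □ hom j i` are mutually inverse equivalences.

The first one sends the regular comodule `hom i i` to `hom i j` (`Cocategory.rowIso`). The
functionals `s` on `hom i j` give `hom j j`-comodule maps `x ↦ s(x₁) x₂` from `hom i l` to
`hom j l`, compatibly with products (`Cocategory.pushLin_pushLin`), so that
`hom i j` is a direct summand of a power of `hom j j`, and conversely
(`Cocategory.IsRetract.isSummand`): it is an ingenerator.
-/

namespace Comod

/-! ### Kernels of comodule maps -/

section General

variable {k C : Type u} [Field k] [AddCommGroup C] [Module k C] [Coalgebra k C]

theorem rTensor_injective {V W : Type u} [AddCommGroup V] [Module k V] [AddCommGroup W]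
    [Module k W] {f : V →ₗ[k] W} (hf : Function.Injective f) (D : Type u) [AddCommGroup D]
    [Module k D] : Function.Injective (f.rTensor D) :=
  Module.Flat.rTensor_preserves_injective_linearMap _ hf

theorem hom_ext_apply {X Y : Comod k C} {f g : X ⟶ Y} (h : ∀ x, f.1 x = g.1 x) : f = g :=
  Subtype.ext (LinearMap.ext h)

/-- Colinearity can be checked after composition with an injective comodule map. -/
theorem mem_com_of_comp {X Y Z : Comod k C} {f : X →ₗ[k] Y} (g : com Y Z)
    (hg : Function.Injective g.1) (h : g.1 ∘ₗ f ∈ com X Z) : f ∈ com X Y := by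
  refine LinearMap.ext fun x => rTensor_injective hg C ?_
  have h1 := com_apply (⟨_, h⟩ : com X Z) x
  simp only [LinearMap.comp_apply, LinearMap.rTensor_comp_apply] at h1 ⊢
  rw [h1, com_apply]

/-- A bijective comodule map is an isomorphism. -/
noncomputable def isoOfBijective {X Y : Comod k C} (f : X ⟶ Y) (hf : Function.Bijective f.1) :
    X ≅ Y where
  hom := f
  inv := ⟨(LinearEquiv.ofBijective f.1 hf).symm.toLinearMap, mem_com_of_comp f hf.1 (by
    have h : f.1 ∘ₗ (LinearEquiv.ofBijective f.1 hf).symm.toLinearMap = LinearMap.id :=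
      LinearMap.ext fun y => (LinearEquiv.ofBijective f.1 hf).apply_symm_apply y
    rw [h]
    exact (𝟙 Y : Y ⟶ Y).2)⟩
  hom_inv_id := hom_ext_apply fun x => (LinearEquiv.ofBijective f.1 hf).symm_apply_apply x
  inv_hom_id := hom_ext_apply fun y => (LinearEquiv.ofBijective f.1 hf).apply_symm_apply y

/-- The kernel of a comodule map, a subcomodule of its source. -/
noncomputable def ker {X Y : Comod k C} (f : X ⟶ Y) : Comod k C :=
  have hmem : ∀ y : LinearMap.ker f.1,
      X.coact y ∈ LinearMap.range ((LinearMap.ker f.1).subtype.rTensor C) := fun y =>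
    mem_range_rTensor _ _ fun φ => by
      rw [LinearMap.mem_ker, ← slice_rTensor, com_apply, y.2, map_zero, map_zero]
  have hinj : ∀ D : Type u, ∀ [AddCommGroup D] [Module k D],
      Function.Injective ((LinearMap.ker f.1).subtype.rTensor D) := fun D _ _ =>
    rTensor_injective (LinearMap.ker f.1).injective_subtype D
  let ρ : LinearMap.ker f.1 →ₗ[k] LinearMap.ker f.1 ⊗[k] C :=
    (LinearEquiv.ofInjective _ (hinj C)).symm.toLinearMap ∘ₗ
      (X.coact ∘ₗ (LinearMap.ker f.1).subtype).codRestrict _ hmem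
  have hj : X.coact ∘ₗ (LinearMap.ker f.1).subtype = (LinearMap.ker f.1).subtype.rTensor C ∘ₗ ρ :=
    LinearMap.ext fun y => (congrArg Subtype.val ((LinearEquiv.ofInjective _
      (hinj C)).apply_symm_apply
        ((X.coact ∘ₗ (LinearMap.ker f.1).subtype).codRestrict _ hmem y))).symm
  { carrier := LinearMap.ker f.1
    coact := ρ
    coassoc := by
      refine LinearMap.ext fun y => hinj (C ⊗[k] C) ?_
      have h1 := LinearMap.congr_fun (coassoc_nat hj) y
      rw [X.coassoc] at h1
      exact h1.symm.trans (LinearMap.congr_fun (comul_nat hj) y)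
    counit := by
      refine LinearMap.ext fun y => (LinearMap.ker f.1).injective_subtype ?_
      have h1 := LinearMap.congr_fun (counit_nat hj) y
      rw [X.counit] at h1
      exact h1.symm }

/-- The inclusion of the kernel. -/
noncomputable def kerι {X Y : Comod k C} (f : X ⟶ Y) : ker f ⟶ X :=
  ⟨(LinearMap.ker f.1).subtype, LinearMap.ext fun _ =>
    congrArg Subtype.val ((LinearEquiv.ofInjective _
      (rTensor_injective (LinearMap.ker f.1).injective_subtype C)).apply_symm_apply _)⟩

theorem kerι_injective {X Y : Comod k C} (f : X ⟶ Y) : Function.Injective (kerι f).1 :=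
  (LinearMap.ker f.1).injective_subtype

theorem apply_kerι {X Y : Comod k C} (f : X ⟶ Y) (y : ker f) : f.1 ((kerι f).1 y) = 0 := y.2

theorem exists_kerι {X Y : Comod k C} (f : X ⟶ Y) {x : X} (hx : f.1 x = 0) :
    ∃ y, (kerι f).1 y = x := ⟨⟨x, hx⟩, rfl⟩

/-- Comodule maps killed by `f` factor through the kernel of `f`. -/
noncomputable def kerLift {X Y Z : Comod k C} (f : X ⟶ Y) (g : Z ⟶ X)
    (h : ∀ z, f.1 (g.1 z) = 0) : Z ⟶ ker f :=
  ⟨g.1.codRestrict (LinearMap.ker f.1) h, mem_com_of_comp (kerι f) (kerι_injective f) g.2⟩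

/-- An element of `X ⊗ D` killed by `f ⊗ 1` comes from `ker f ⊗ D`. -/
theorem exists_rTensor_kerι {X Y : Comod k C} (f : X ⟶ Y) {D : Type u} [AddCommGroup D]
    [Module k D] {t : X ⊗[k] D} (ht : f.1.rTensor D t = 0) :
    ∃ z, (kerι f).1.rTensor D z = t :=
  mem_range_rTensor (LinearMap.ker f.1) t fun φ => by
    rw [LinearMap.mem_ker, ← slice_rTensor, ht, map_zero]

/-! ### The comodules `V ⊗ Y` -/

/-- The comodule `V ⊗ Y`, where the coalgebra coacts on the factor `Y`. -/
noncomputable def tens (V : Type u) [AddCommGroup V] [Module k V] (Y : Comod k C) :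
    Comod k C where
  carrier := V ⊗[k] Y
  coact := (TensorProduct.assoc k V Y C).symm.toLinearMap ∘ₗ Y.coact.lTensor V
  coassoc := TensorProduct.ext (LinearMap.ext fun v => coassoc_comp _ Y (TensorProduct.mk k V Y v)
    (by
      have h : (TensorProduct.assoc k V Y C).symm.toLinearMap ∘ₗ TensorProduct.mk k V (Y ⊗[k] C) v
          = (TensorProduct.mk k V Y v).rTensor C := by ext; simp
      rw [← h]; rfl))
  counit := TensorProduct.ext (LinearMap.ext fun v => counit_comp _ Y (TensorProduct.mk k V Y v)
    (by
      have h : (TensorProduct.assoc k V Y C).symm.toLinearMap ∘ₗ TensorProduct.mk k V (Y ⊗[k] C) v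
          = (TensorProduct.mk k V Y v).rTensor C := by ext; simp
      rw [← h]; rfl))

variable {V W : Type u} [AddCommGroup V] [Module k V] [AddCommGroup W] [Module k W]

/-- Comodule maps to `V ⊗ Y` are the colinear maps in the sense of `IsColinear`. -/
theorem mem_com_tens_iff {X Y : Comod k C} (f : X →ₗ[k] V ⊗[k] Y) :
    f ∈ com X (tens V Y) ↔ IsColinear X Y f := by
  change _ = (TensorProduct.assoc k V Y C).symm.toLinearMap ∘ₗ Y.coact.lTensor V ∘ₗ f ↔ _ = _
  exact (LinearEquiv.eq_toLinearMap_symm_comp _ _).trans Iff.rfl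

/-- The comodule map `v ⊗ 1`. -/
noncomputable def tensMap (v : V →ₗ[k] W) (Y : Comod k C) : tens V Y ⟶ tens W Y :=
  ⟨v.rTensor Y, LinearMap.ext fun (t : V ⊗[k] Y) => show (v.rTensor Y).rTensor C
      ((TensorProduct.assoc k V Y C).symm (Y.coact.lTensor V t)) =
      (TensorProduct.assoc k W Y C).symm (Y.coact.lTensor W (v.rTensor Y t)) by
    rw [assoc_symm_rTensor, lTensor_rTensor_apply]⟩

/-- The comodule map `1 ⊗ f`. -/
noncomputable def tensMapRight (V : Type u) [AddCommGroup V] [Module k V] {X Y : Comod k C}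
    (f : X ⟶ Y) : tens V X ⟶ tens V Y :=
  ⟨f.1.lTensor V, LinearMap.ext fun (t : V ⊗[k] X) => show (f.1.lTensor V).rTensor C
      ((TensorProduct.assoc k V X C).symm (X.coact.lTensor V t)) =
      (TensorProduct.assoc k V Y C).symm (Y.coact.lTensor V (f.1.lTensor V t)) by
    rw [assoc_symm_lTensor, ← LinearMap.lTensor_comp_apply, ← LinearMap.lTensor_comp_apply, f.2]⟩

/-- The associativity isomorphism as a comodule map. -/
noncomputable def tensAssoc (V W : Type u) [AddCommGroup V] [Module k V] [AddCommGroup W]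
    [Module k W] (Y : Comod k C) : tens (V ⊗[k] W) Y ⟶ tens V (tens W Y) :=
  ⟨(TensorProduct.assoc k V W Y).toLinearMap, by
    refine TensorProduct.ext_threefold fun v w y => ?_
    change (TensorProduct.assoc k V W Y).toLinearMap.rTensor C
      ((TensorProduct.assoc k (V ⊗[k] W) Y C).symm ((v ⊗ₜ w) ⊗ₜ Y.coact y)) =
      (TensorProduct.assoc k V (W ⊗[k] Y) C).symm
        (v ⊗ₜ ((TensorProduct.assoc k W Y C).symm (w ⊗ₜ Y.coact y)))
    induction Y.coact y using TensorProduct.induction_on with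
    | zero => simp
    | tmul y c => simp
    | add s t hs ht => simp only [tmul_add, map_add, hs, ht]⟩

/-! ### Direct summands of powers -/

/-- `X` is a direct summand of a finite direct sum of copies of `Y`, expressed through the
components of the inclusion and of the projection. -/
def IsSummand (X Y : Comod k C) : Prop :=
  ∃ (n : ℕ) (s : Fin n → (X ⟶ Y)) (r : Fin n → (Y ⟶ X)), ∑ a, s a ≫ r a = 𝟙 X

theorem hom_sum_apply {X Y : Comod k C} {ι : Type*} (s : Finset ι) (f : ι → (X ⟶ Y)) (x : X) :
    (∑ a ∈ s, f a).1 x = ∑ a ∈ s, (f a).1 x := by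
  have h : (∑ a ∈ s, f a).1 = ∑ a ∈ s, (f a).1 := AddSubmonoidClass.coe_finsetSum _ _
  rw [h, LinearMap.sum_apply]

theorem IsSummand.of_iso {X X' Y : Comod k C} (h : IsSummand X Y) (e : X ≅ X') :
    IsSummand X' Y := by
  obtain ⟨n, s, r, h⟩ := h
  refine ⟨n, fun a => e.inv ≫ s a, fun a => r a ≫ e.hom, ?_⟩
  calc _ = e.inv ≫ (∑ a, s a ≫ r a) ≫ e.hom := by
        simp [Preadditive.sum_comp, Preadditive.comp_sum]
    _ = 𝟙 X' := by rw [h, Category.id_comp, e.inv_hom_id]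

theorem IsSummand.of_iso_right {X Y Y' : Comod k C} (h : IsSummand X Y) (e : Y ≅ Y') :
    IsSummand X Y' := by
  obtain ⟨n, s, r, h⟩ := h
  exact ⟨n, fun a => s a ≫ e.hom, fun a => e.inv ≫ r a, by simpa using h⟩

/-- The inclusion of a summand of a power. -/
def powerι (Y : Comod k C) {n : ℕ} (a : Fin n) : Y ⟶ Y.power n :=
  ⟨LinearMap.single k (fun _ : Fin n => (Y : Type u)) a,
    (directSum_coact (fun _ : Fin n => Y) a).symm⟩

/-- The projection of a power onto a summand. -/
def powerπ (Y : Comod k C) {n : ℕ} (a : Fin n) : Y.power n ⟶ Y :=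
  ⟨LinearMap.proj (φ := fun _ : Fin n => (Y : Type u)) a, by
    refine LinearMap.pi_ext' fun b => ?_
    have h := directSum_coact (fun _ : Fin n => Y) b
    refine (congrArg (LinearMap.comp ((LinearMap.proj (R := k)
      (φ := fun _ : Fin n => (Y : Type u)) a).rTensor C)) h).trans ?_
    rw [← LinearMap.comp_assoc, ← LinearMap.rTensor_comp]
    by_cases hab : a = b
    · subst hab
      rw [LinearMap.proj_comp_single_same, LinearMap.rTensor_id, LinearMap.id_comp]
      exact LinearMap.ext fun y =>
        (congrArg Y.coact (Pi.single_eq_same (M := fun _ : Fin n => (Y : Type u)) a y)).symm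
    · rw [LinearMap.proj_comp_single_ne _ _ _ _ hab, LinearMap.rTensor_zero, LinearMap.zero_comp]
      exact LinearMap.ext fun y => ((congrArg Y.coact
        (Pi.single_eq_of_ne (M := fun _ : Fin n => (Y : Type u)) hab y)).trans
          (map_zero _)).symm⟩

theorem sum_powerπ_powerι (Y : Comod k C) (n : ℕ) :
    ∑ a : Fin n, Y.powerπ a ≫ Y.powerι a = 𝟙 (Y.power n) :=
  hom_ext_apply fun x => by
    rw [hom_sum_apply]
    exact LinearMap.sum_single_apply (fun _ : Fin n => (Y : Type u)) x

theorem powerι_powerπ (Y : Comod k C) {n : ℕ} (a b : Fin n) :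
    Y.powerι a ≫ Y.powerπ b = if a = b then 𝟙 Y else 0 := by
  refine hom_ext_apply fun x => ?_
  change Pi.single (M := fun _ : Fin n => (Y : Type u)) a x b = _
  split_ifs with h
  · subst h
    exact Pi.single_eq_same _ _
  · exact Pi.single_eq_of_ne (Ne.symm h) _

/-- The inclusion of the first summand of a direct sum. -/
def prodInl (X P : Comod k C) : X ⟶ X.prod P :=
  ⟨LinearMap.inl k X P, LinearMap.ext fun x => show (LinearMap.inl k X P).rTensor C (X.coact x) =
      (LinearMap.inl k X P).rTensor C (X.coact x) + (LinearMap.inr k X P).rTensor C (P.coact 0) by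
    simp⟩

/-- The projection onto the first summand of a direct sum. -/
def prodFst (X P : Comod k C) : X.prod P ⟶ X :=
  ⟨LinearMap.fst k X P, LinearMap.ext fun (x : X × P) => show (LinearMap.fst k X P).rTensor C
      ((LinearMap.inl k X P).rTensor C (X.coact x.1) +
        (LinearMap.inr k X P).rTensor C (P.coact x.2)) = X.coact x.1 by
    rw [map_add, ← LinearMap.rTensor_comp_apply, ← LinearMap.rTensor_comp_apply,
      LinearMap.fst_comp_inl, LinearMap.fst_comp_inr]
    simp⟩

theorem IsSummand.of_prod_iso {X Y P : Comod k C} {n : ℕ} (e : X.prod P ≅ Y.power n) :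
    IsSummand X Y := by
  refine ⟨n, fun a => X.prodInl P ≫ e.hom ≫ Y.powerπ a,
    fun a => Y.powerι a ≫ e.inv ≫ X.prodFst P, ?_⟩
  calc _ = X.prodInl P ≫ e.hom ≫ (∑ a : Fin n, Y.powerπ a ≫ Y.powerι a) ≫ e.inv ≫ X.prodFst P := by
        simp [Preadditive.comp_sum, Preadditive.sum_comp]
    _ = X.prodInl P ≫ X.prodFst P := by simp [sum_powerπ_powerι]
    _ = 𝟙 X := rfl

/-- The complement of a direct summand of a power is the kernel of the projection. -/
theorem IsSummand.exists_prod_iso {X Y : Comod k C} (h : IsSummand X Y) :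
    ∃ (n : ℕ) (P : Comod k C), Nonempty (X.prod P ≅ Y.power n) := by
  obtain ⟨n, s, r, h⟩ := h
  -- `i` and `p` are the inclusion and the projection with components `s` and `r`
  let i : X ⟶ Y.power n := ∑ a, s a ≫ Y.powerι a
  let p : Y.power n ⟶ X := ∑ a, Y.powerπ a ≫ r a
  have hip : i ≫ p = 𝟙 X := by
    rw [← h]
    simp only [i, p, Preadditive.sum_comp, Preadditive.comp_sum, Category.assoc]
    refine Finset.sum_congr rfl fun a _ => ?_
    rw [Finset.sum_eq_single a]
    · rw [← Category.assoc (Y.powerι a), powerι_powerπ, if_pos rfl, Category.id_comp]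
    · intro b _ hb
      rw [← Category.assoc (Y.powerι b), powerι_powerπ, if_neg hb]
      simp
    · simp
  have hip' : ∀ x, p.1 (i.1 x) = x := fun x => congrArg (fun f : X ⟶ X => f.1 x) hip
  let f : (X × ker p) →ₗ[k] Y.power n := i.1.coprod (kerι p).1
  have hf : f ∈ com (X.prod (ker p)) (Y.power n) := by
    have h1 : f ∘ₗ LinearMap.inl k X (ker p) = i.1 := LinearMap.coprod_inl _ _
    have h2 : f ∘ₗ LinearMap.inr k X (ker p) = (kerι p).1 := LinearMap.coprod_inr _ _
    refine LinearMap.ext fun (x : X × ker p) => ?_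
    change f.rTensor C ((LinearMap.inl k X (ker p)).rTensor C (X.coact x.1) +
      (LinearMap.inr k X (ker p)).rTensor C ((ker p).coact x.2)) = (Y.power n).coact (i.1 x.1 +
        (kerι p).1 x.2)
    rw [map_add, map_add, ← LinearMap.rTensor_comp_apply, ← LinearMap.rTensor_comp_apply, h1, h2,
      com_apply, com_apply]
  refine ⟨n, ker p, ⟨isoOfBijective ⟨f, hf⟩ ⟨?_, ?_⟩⟩⟩
  · refine (injective_iff_map_eq_zero f).2 ?_
    rintro ⟨x, y⟩ (hxy : i.1 x + (kerι p).1 y = 0)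
    have hx : x = 0 := by
      have := congrArg p.1 hxy
      rwa [map_add, hip', apply_kerι, add_zero, map_zero] at this
    subst hx
    rw [map_zero, zero_add] at hxy
    rw [kerι_injective p (hxy.trans (map_zero _).symm)]
    rfl
  · intro z
    obtain ⟨y, hy⟩ := exists_kerι p (x := z - i.1 (p.1 z)) (by rw [map_sub, hip', sub_self])
    exact ⟨(p.1 z, y), by
      change i.1 (p.1 z) + (kerι p).1 y = z
      rw [hy, add_sub_cancel]⟩

end General

end Comod

/-! ### Cocategories -/

/-- A `k`-linear cocategory with set of objects `ι`: the notion dual to that of a `k`-linear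
category. It consists of vector spaces `K.hom i j` with a coassociative and counital
comultiplication `K.hom i l → K.hom i j ⊗ K.hom j l`. -/
structure Cocategory (k : Type u) [Field k] (ι : Type*) where
  /-- the spaces of a cocategory -/
  hom : ι → ι → Type u
  [addCommGroup : ∀ i j, AddCommGroup (hom i j)]
  [module : ∀ i j, Module k (hom i j)]
  /-- the comultiplication -/
  comul : ∀ i j l, hom i l →ₗ[k] hom i j ⊗[k] hom j l
  /-- the counit -/
  counit : ∀ i, hom i i →ₗ[k] k
  coassoc : ∀ i j l m, (TensorProduct.assoc k (hom i j) (hom j l) (hom l m)).toLinearMap ∘ₗ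
    (comul i j l).rTensor (hom l m) ∘ₗ comul i l m =
      (comul j l m).lTensor (hom i j) ∘ₗ comul i j m
  rTensor_counit : ∀ i j,
    (counit i).rTensor (hom i j) ∘ₗ comul i i j = TensorProduct.mk k k (hom i j) 1
  lTensor_counit : ∀ i j,
    (counit j).lTensor (hom i j) ∘ₗ comul i j j = (TensorProduct.mk k (hom i j) k).flip 1

namespace Cocategory

attribute [instance] Cocategory.addCommGroup Cocategory.module

open Comod

variable {k : Type u} [Field k] {ι : Type*} (K : Cocategory k ι)

instance (i : ι) : Coalgebra k (K.hom i i) where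
  comul := K.comul i i i
  counit := K.counit i
  coassoc := K.coassoc i i i i
  rTensor_counit_comp_comul := K.rTensor_counit i i
  lTensor_counit_comp_comul := K.lTensor_counit i i

theorem coassoc_apply (i j l m : ι) (x : K.hom i m) :
    TensorProduct.assoc k (K.hom i j) (K.hom j l) (K.hom l m)
      ((K.comul i j l).rTensor (K.hom l m) (K.comul i l m x)) =
      (K.comul j l m).lTensor (K.hom i j) (K.comul i j m x) :=
  LinearMap.congr_fun (K.coassoc i j l m) x

theorem slice_counit (i j : ι) (x : K.hom i j) :
    slice (K.hom i j) (K.counit j) (K.comul i j j x) = x := by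
  have h := LinearMap.congr_fun (K.lTensor_counit i j) x
  simp only [LinearMap.comp_apply] at h
  simp [slice, h]

theorem lslice_counit (i j : ι) (x : K.hom i j) :
    lslice (K.hom i j) (K.counit i) (K.comul i i j x) = x := by
  have h := LinearMap.congr_fun (K.rTensor_counit i j) x
  simp only [LinearMap.comp_apply] at h
  simp [lslice, h]

/-- The space `K.hom i j` as a right comodule over `K.hom j j`. -/
def row (i j : ι) : Comod k (K.hom j j) where
  carrier := K.hom i j
  coact := K.comul i j j
  coassoc := K.coassoc i j j j
  counit := LinearMap.ext fun x => K.slice_counit i j x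

/-- The map `x ↦ s(x₁) x₂` given by a functional `s` on `K.hom i j`. -/
noncomputable def pushLin {i j : ι} (s : K.hom i j →ₗ[k] k) (l : ι) : K.hom i l →ₗ[k] K.hom j l :=
  lslice (K.hom j l) s ∘ₗ K.comul i j l

theorem pushLin_apply {i j : ι} (s : K.hom i j →ₗ[k] k) (l : ι) (x : K.hom i l) :
    K.pushLin s l x = lslice (K.hom j l) s (K.comul i j l x) := rfl

/-- The map `x ↦ s(x₁) x₂` as a comodule map. -/
noncomputable def push {i j : ι} (s : K.hom i j →ₗ[k] k) (l : ι) : K.row i l ⟶ K.row j l :=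
  ⟨K.pushLin s l, LinearMap.ext fun (x : K.hom i l) =>
    show (K.pushLin s l).rTensor (K.hom l l) (K.comul i l l x) =
      K.comul j l l (K.pushLin s l x) by
    rw [pushLin, LinearMap.rTensor_comp_apply, ← lslice_assoc, coassoc_apply, lslice_lTensor]
    rfl⟩

/-- The product `(s ⊗ r) Δ` of two functionals, the analogue of composition. -/
noncomputable def convol {i j l : ι} (s : K.hom i j →ₗ[k] k) (r : K.hom j l →ₗ[k] k) :
    K.hom i l →ₗ[k] k :=
  r ∘ₗ K.pushLin s l

theorem pushLin_pushLin {i j l : ι} (s : K.hom i j →ₗ[k] k) (r : K.hom j l →ₗ[k] k) (m : ι)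
    (x : K.hom i m) : K.pushLin r m (K.pushLin s m x) = K.pushLin (K.convol s r) m x := by
  rw [pushLin_apply, pushLin_apply, pushLin_apply, ← lslice_lTensor, ← coassoc_apply,
    lslice_assoc, lslice_rTensor, lslice_rTensor]
  rfl

/-- The object `i` is a retract of a finite sum of copies of `j`: the counit of `i` is a sum of
products of functionals on `K.hom i j` and on `K.hom j i`. When these functionals come from maps
`s a : i ⟶ j` and `r a : j ⟶ i`, this says `∑ a, s a ≫ r a = 𝟙 i`. -/
def IsRetract (i j : ι) : Prop :=
  ∃ (n : ℕ) (s : Fin n → (K.hom i j →ₗ[k] k)) (r : Fin n → (K.hom j i →ₗ[k] k)),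
    ∑ a, K.convol (s a) (r a) = K.counit i

variable {K}

theorem IsRetract.isSummand {i j : ι} (h : K.IsRetract i j) (l : ι) :
    IsSummand (K.row i l) (K.row j l) := by
  obtain ⟨n, s, r, h⟩ := h
  refine ⟨n, fun a => K.push (s a) l, fun a => K.push (r a) l,
    hom_ext_apply fun (x : K.hom i l) => ?_⟩
  refine (hom_sum_apply (X := K.row i l) (Y := K.row i l) _ _ x).trans ?_
  change ∑ a, K.pushLin (r a) l (K.pushLin (s a) l x) = x
  simp only [pushLin_pushLin]
  refine Eq.trans ?_ (K.lslice_counit i l x)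
  rw [← h]
  have h1 : (∑ a, K.convol (s a) (r a)).rTensor (K.hom i l) =
      ∑ a, (K.convol (s a) (r a)).rTensor (K.hom i l) :=
    map_sum (LinearMap.rTensorHom (K.hom i l)) _ _
  simp [pushLin_apply, lslice, h1]

/-- The functional `τ` is `∑ a, s a ⊗ r a`. -/
theorem IsRetract.exists_pairing {i j : ι} (h : K.IsRetract i j) :
    ∃ τ : K.hom i j ⊗[k] K.hom j i →ₗ[k] k, τ ∘ₗ K.comul i j i = K.counit i := by
  obtain ⟨n, s, r, h⟩ := h
  refine ⟨∑ a, r a ∘ₗ lslice (K.hom j i) (s a), ?_⟩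
  rw [← h]
  ext x
  simp [convol, pushLin_apply]

end Cocategory

/-! ### Associativity of tensor products and slice maps -/

namespace Comod

section Tensor

variable {k : Type u} [Field k] {V W X Y Z A : Type u} [AddCommGroup V] [Module k V]
  [AddCommGroup W] [Module k W] [AddCommGroup X] [Module k X] [AddCommGroup Y] [Module k Y]
  [AddCommGroup Z] [Module k Z] [AddCommGroup A] [Module k A]

theorem assoc_lTensor_rTensor (f : V →ₗ[k] W) (t : (X ⊗[k] V) ⊗[k] Y) :
    TensorProduct.assoc k X W Y ((f.lTensor X).rTensor Y t) =
      (f.rTensor Y).lTensor X (TensorProduct.assoc k X V Y t) :=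
  LinearMap.congr_fun (f := (TensorProduct.assoc k X W Y).toLinearMap ∘ₗ (f.lTensor X).rTensor Y)
    (g := (f.rTensor Y).lTensor X ∘ₗ (TensorProduct.assoc k X V Y).toLinearMap) (by ext; simp) t

theorem assoc_lTensor (f : V →ₗ[k] W) (t : (X ⊗[k] Y) ⊗[k] V) :
    TensorProduct.assoc k X Y W (f.lTensor (X ⊗[k] Y) t) =
      (f.lTensor Y).lTensor X (TensorProduct.assoc k X Y V t) :=
  LinearMap.congr_fun (f := (TensorProduct.assoc k X Y W).toLinearMap ∘ₗ f.lTensor (X ⊗[k] Y))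
    (g := (f.lTensor Y).lTensor X ∘ₗ (TensorProduct.assoc k X Y V).toLinearMap) (by ext; simp) t

/-- The pentagon identity. -/
theorem assoc_assoc (t : ((X ⊗[k] V) ⊗[k] W) ⊗[k] Y) :
    TensorProduct.assoc k X V (W ⊗[k] Y) (TensorProduct.assoc k (X ⊗[k] V) W Y t) =
      (TensorProduct.assoc k V W Y).toLinearMap.lTensor X (TensorProduct.assoc k X (V ⊗[k] W) Y
        ((TensorProduct.assoc k X V W).toLinearMap.rTensor Y t)) :=
  LinearMap.congr_fun (f := (TensorProduct.assoc k X V (W ⊗[k] Y)).toLinearMap ∘ₗ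
      (TensorProduct.assoc k (X ⊗[k] V) W Y).toLinearMap)
    (g := (TensorProduct.assoc k V W Y).toLinearMap.lTensor X ∘ₗ
      (TensorProduct.assoc k X (V ⊗[k] W) Y).toLinearMap ∘ₗ
        (TensorProduct.assoc k X V W).toLinearMap.rTensor Y) (by ext; simp) t

theorem slice_assoc (φ : V →ₗ[k] k) (t : (X ⊗[k] A) ⊗[k] V) :
    slice (X ⊗[k] A) φ t =
      (slice A φ).lTensor X (TensorProduct.assoc k X A V t) :=
  LinearMap.congr_fun (f := slice (X ⊗[k] A) φ) (g := (slice A φ).lTensor X ∘ₗ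
    (TensorProduct.assoc k X A V).toLinearMap) (by ext; simp [slice_tmul]) t

theorem slice_lTensor (φ : V →ₗ[k] k) (f : W →ₗ[k] V) (t : X ⊗[k] W) :
    slice X φ (f.lTensor X t) = slice X (φ ∘ₗ f) t := by
  simp [slice, LinearMap.lTensor_comp]

theorem slice_assoc_tmul (τ : V ⊗[k] W →ₗ[k] k) (s : A ⊗[k] V) (w : W) :
    slice A τ (TensorProduct.assoc k A V W (s ⊗ₜ w)) =
      slice A (τ ∘ₗ (TensorProduct.mk k V W).flip w) s :=
  LinearMap.congr_fun (f := slice A τ ∘ₗ (TensorProduct.assoc k A V W).toLinearMap ∘ₗ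
    (TensorProduct.mk k (A ⊗[k] V) W).flip w)
    (g := slice A (τ ∘ₗ (TensorProduct.mk k V W).flip w))
    (by ext; simp [slice_tmul]) s

end Tensor

end Comod

/-! ### Cotensor products -/

namespace Cocategory

open Comod

variable {k : Type u} [Field k] {ι : Type*} (K : Cocategory k ι)

/-- The comultiplication `K.hom i l → K.hom i j ⊗ K.hom j l` as a comodule map. -/
noncomputable def rowComul (i j l : ι) : K.row i l ⟶ tens (K.hom i j) (K.row j l) :=
  ⟨K.comul i j l, (mem_com_tens_iff (X := K.row i l) (Y := K.row j l) (K.comul i j l)).2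
    (K.coassoc i j l l)⟩

section

variable {i : ι} (X : Comod k (K.hom i i)) (j : ι)

/-- The map `ρ ⊗ 1 - 1 ⊗ Δ` from `X ⊗ K.hom i j` to `X ⊗ (K.hom i i ⊗ K.hom i j)`, whose kernel
is the cotensor product. -/
noncomputable def cotensorMap :
    tens X (K.row i j) ⟶ tens X (tens (K.hom i i) (K.row i j)) :=
  tensMap X.coact (K.row i j) ≫ tensAssoc X (K.hom i i) (K.row i j) -
    tensMapRight X (K.rowComul i i j)

/-- The cotensor product of `X` with `K.hom i j`. -/
noncomputable def cotensor : Comod k (K.hom j j) := ker (K.cotensorMap X j)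

/-- The inclusion of the cotensor product into the tensor product. -/
noncomputable def incl : K.cotensor X j →ₗ[k] X ⊗[k] K.hom i j := (kerι (K.cotensorMap X j)).1

theorem incl_injective : Function.Injective (K.incl X j) := kerι_injective _

/-- The cotensor condition `(ρ ⊗ 1) y = (1 ⊗ Δ) y`. -/
theorem assoc_incl (y : K.cotensor X j) :
    TensorProduct.assoc k X (K.hom i i) (K.hom i j) (X.coact.rTensor (K.hom i j) (K.incl X j y)) =
      (K.comul i i j).lTensor X (K.incl X j y) :=
  sub_eq_zero.1 (apply_kerι (K.cotensorMap X j) y)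

theorem exists_incl {t : X ⊗[k] K.hom i j}
    (h : TensorProduct.assoc k X (K.hom i i) (K.hom i j) (X.coact.rTensor (K.hom i j) t) =
      (K.comul i i j).lTensor X t) : ∃ y, K.incl X j y = t :=
  exists_kerι (K.cotensorMap X j) (sub_eq_zero.2 h)

/-- The coaction on the cotensor product is the restriction of `1 ⊗ Δ`. -/
theorem coact_incl (y : K.cotensor X j) :
    TensorProduct.assoc k X (K.hom i j) (K.hom j j)
      ((K.incl X j).rTensor (K.hom j j) ((K.cotensor X j).coact y)) =
      (K.comul i j j).lTensor X (K.incl X j y) := by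
  have h : (K.incl X j).rTensor (K.hom j j) ((K.cotensor X j).coact y) =
      (TensorProduct.assoc k X (K.hom i j) (K.hom j j)).symm
        ((K.comul i j j).lTensor X (K.incl X j y)) := com_apply (kerι (K.cotensorMap X j)) y
  rw [h, LinearEquiv.apply_symm_apply]

variable {X} in
/-- The comodule map induced by `u ⊗ 1` on cotensor products. -/
noncomputable def cotensorHom {Y : Comod k (K.hom i i)} (u : X ⟶ Y) :
    K.cotensor X j ⟶ K.cotensor Y j :=
  kerLift (K.cotensorMap Y j) (kerι (K.cotensorMap X j) ≫ tensMap u.1 (K.row i j)) fun z => by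
    refine sub_eq_zero.2 ?_
    change TensorProduct.assoc k Y (K.hom i i) (K.hom i j)
      (Y.coact.rTensor (K.hom i j) (u.1.rTensor (K.hom i j) (K.incl X j z))) =
      (K.comul i i j).lTensor Y (u.1.rTensor (K.hom i j) (K.incl X j z))
    rw [← LinearMap.rTensor_comp_apply, ← u.2, LinearMap.rTensor_comp_apply, assoc_rTensor,
      assoc_incl, lTensor_rTensor_apply]

variable {X} in
theorem incl_cotensorHom {Y : Comod k (K.hom i i)} (u : X ⟶ Y) (z : K.cotensor X j) :
    K.incl Y j ((K.cotensorHom j u).1 z) = u.1.rTensor (K.hom i j) (K.incl X j z) := rfl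

end

/-- Cotensoring with `K.hom i j`, as a functor. -/
noncomputable def cotensorFunctor (i j : ι) : Comod k (K.hom i i) ⥤ Comod k (K.hom j j) where
  obj X := K.cotensor X j
  map u := K.cotensorHom j u
  map_id X := hom_ext_apply fun z => K.incl_injective X j <|
    (K.incl_cotensorHom j (𝟙 X) z).trans (LinearMap.rTensor_id_apply _ _ _)
  map_comp {_ _ Z} u v := hom_ext_apply fun z => K.incl_injective Z j <|
    (K.incl_cotensorHom j (u ≫ v) z).trans (LinearMap.rTensor_comp_apply _ v.1 u.1 _)

instance (i j : ι) : (K.cotensorFunctor i j).Additive where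
  map_add {X Y} u v := hom_ext_apply fun z => K.incl_injective Y j <| by
    refine (K.incl_cotensorHom j (u + v) z).trans ?_
    change (u.1 + v.1).rTensor (K.hom i j) (K.incl X j z) = K.incl Y j
      ((K.cotensorHom j u).1 z + (K.cotensorHom j v).1 z)
    rw [map_add, LinearMap.rTensor_add, LinearMap.add_apply]
    rfl

instance (i j : ι) : (K.cotensorFunctor i j).Linear k where
  map_smul {X Y} u a := hom_ext_apply fun z => K.incl_injective Y j <| by
    refine (K.incl_cotensorHom j (a • u) z).trans ?_
    change (a • u.1).rTensor (K.hom i j) (K.incl X j z) = K.incl Y j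
      (a • (K.cotensorHom j u).1 z)
    rw [map_smul, LinearMap.rTensor_smul, LinearMap.smul_apply]
    rfl

end Cocategory

/-! ### Iterated cotensor products -/

namespace Cocategory

open Comod

variable {k : Type u} [Field k] {ι : Type*} (K : Cocategory k ι)

section

variable {i : ι} (X : Comod k (K.hom i i)) (j : ι)

/-- The embedding of `(X □ K.hom i j) ⊗ K.hom j i` into `X ⊗ (K.hom i j ⊗ K.hom j i)`. -/
noncomputable def inclTensor :
    K.cotensor X j ⊗[k] K.hom j i →ₗ[k] X ⊗[k] (K.hom i j ⊗[k] K.hom j i) :=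
  (TensorProduct.assoc k X (K.hom i j) (K.hom j i)).toLinearMap ∘ₗ
    (K.incl X j).rTensor (K.hom j i)

theorem inclTensor_apply (w : K.cotensor X j ⊗[k] K.hom j i) : K.inclTensor X j w =
    TensorProduct.assoc k X (K.hom i j) (K.hom j i) ((K.incl X j).rTensor (K.hom j i) w) := rfl

theorem inclTensor_injective : Function.Injective (K.inclTensor X j) :=
  (TensorProduct.assoc k X (K.hom i j) (K.hom j i)).injective.comp
    (rTensor_injective (K.incl_injective X j) _)

/-- Coacting on `X` before and after reassociating `(X ⊗ K.hom i j) ⊗ K.hom j i`. -/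
theorem assoc_assoc_rTensor_coact (t : (X ⊗[k] K.hom i j) ⊗[k] K.hom j i) :
    (TensorProduct.assoc k (K.hom i i) (K.hom i j) (K.hom j i)).toLinearMap.lTensor X
      (TensorProduct.assoc k X (K.hom i i ⊗[k] K.hom i j) (K.hom j i)
        ((((TensorProduct.assoc k X (K.hom i i) (K.hom i j)).toLinearMap ∘ₗ
          X.coact.rTensor (K.hom i j))).rTensor (K.hom j i) t)) =
    TensorProduct.assoc k X (K.hom i i) (K.hom i j ⊗[k] K.hom j i)
      (X.coact.rTensor (K.hom i j ⊗[k] K.hom j i)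
        (TensorProduct.assoc k X (K.hom i j) (K.hom j i) t)) := by
  rw [← assoc_rTensor, assoc_assoc, LinearMap.rTensor_comp_apply]

/-- The cotensor condition over `K.hom i i` for elements of `(X □ K.hom i j) ⊗ K.hom j i`. -/
theorem assoc_coact_inclTensor (w : K.cotensor X j ⊗[k] K.hom j i) :
    TensorProduct.assoc k X (K.hom i i) (K.hom i j ⊗[k] K.hom j i)
      (X.coact.rTensor (K.hom i j ⊗[k] K.hom j i) (K.inclTensor X j w)) =
    ((TensorProduct.assoc k (K.hom i i) (K.hom i j) (K.hom j i)).toLinearMap ∘ₗ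
      (K.comul i i j).rTensor (K.hom j i)).lTensor X (K.inclTensor X j w) := by
  have h : ((TensorProduct.assoc k X (K.hom i i) (K.hom i j)).toLinearMap ∘ₗ
      X.coact.rTensor (K.hom i j)) ∘ₗ K.incl X j = (K.comul i i j).lTensor X ∘ₗ K.incl X j :=
    LinearMap.ext (K.assoc_incl X j)
  rw [inclTensor_apply, ← assoc_assoc_rTensor_coact, ← LinearMap.rTensor_comp_apply, h,
    LinearMap.rTensor_comp_apply, assoc_lTensor_rTensor, LinearMap.lTensor_comp_apply]

/-- The coaction of `K.hom j j` on `X □ K.hom i j`, seen in `X ⊗ (K.hom i j ⊗ K.hom j i)`. -/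
theorem assoc_incl_coact_rTensor (w : K.cotensor X j ⊗[k] K.hom j i) :
    TensorProduct.assoc k X (K.hom i j) (K.hom j j ⊗[k] K.hom j i)
      ((K.incl X j).rTensor (K.hom j j ⊗[k] K.hom j i)
        (TensorProduct.assoc k (K.cotensor X j) (K.hom j j) (K.hom j i)
          ((K.cotensor X j).coact.rTensor (K.hom j i) w))) =
    ((TensorProduct.assoc k (K.hom i j) (K.hom j j) (K.hom j i)).toLinearMap ∘ₗ
      (K.comul i j j).rTensor (K.hom j i)).lTensor X (K.inclTensor X j w) := by
  have h : ((TensorProduct.assoc k X (K.hom i j) (K.hom j j)).toLinearMap ∘ₗ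
      (K.incl X j).rTensor (K.hom j j)) ∘ₗ (K.cotensor X j).coact =
      (K.comul i j j).lTensor X ∘ₗ K.incl X j :=
    LinearMap.ext (K.coact_incl X j)
  rw [← assoc_rTensor, assoc_assoc, ← LinearMap.rTensor_comp_apply, ← LinearMap.rTensor_comp_apply,
    h, LinearMap.rTensor_comp_apply, assoc_lTensor_rTensor, LinearMap.lTensor_comp_apply]
  rfl

theorem assoc_incl_lTensor (w : K.cotensor X j ⊗[k] K.hom j i) :
    TensorProduct.assoc k X (K.hom i j) (K.hom j j ⊗[k] K.hom j i)
      ((K.incl X j).rTensor (K.hom j j ⊗[k] K.hom j i) ((K.comul j j i).lTensor _ w)) =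
    ((K.comul j j i).lTensor (K.hom i j)).lTensor X (K.inclTensor X j w) := by
  rw [← lTensor_rTensor_apply, assoc_lTensor]
  rfl

/-- The embedding of `(X □ K.hom i j) □ K.hom j i` into `X ⊗ (K.hom i j ⊗ K.hom j i)`. -/
noncomputable def incl₂ : K.cotensor (K.cotensor X j) i ⟶
    tens X (tens (K.hom i j) (K.row j i)) :=
  kerι (K.cotensorMap (K.cotensor X j) i) ≫ tensMap (K.incl X j) (K.row j i) ≫
    tensAssoc X (K.hom i j) (K.row j i)

theorem incl₂_apply (z : K.cotensor (K.cotensor X j) i) :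
    (K.incl₂ X j).1 z = K.inclTensor X j (K.incl (K.cotensor X j) i z) := rfl

theorem incl₂_injective : Function.Injective (K.incl₂ X j).1 :=
  (K.inclTensor_injective X j).comp (K.incl_injective (K.cotensor X j) i)

/-- The comodule map `(1 ⊗ Δ) ρ`, whose image is `(X □ K.hom i j) □ K.hom j i`. -/
noncomputable def expand : X ⟶ tens X (tens (K.hom i j) (K.row j i)) :=
  (⟨X.coact, (mem_com_tens_iff (Y := K.row i i) X.coact).2 X.coassoc⟩ : X ⟶ tens X (K.row i i)) ≫
    tensMapRight X (K.rowComul i j i)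

theorem expand_apply (x : X) : (K.expand X j).1 x = (K.comul i j i).lTensor X (X.coact x) := rfl

theorem slice_counit_coact (x : X) : slice X (K.counit i) (X.coact x) = x :=
  LinearMap.congr_fun X.counit x

theorem slice_expand {j : ι} {τ : K.hom i j ⊗[k] K.hom j i →ₗ[k] k}
    (hτ : τ ∘ₗ K.comul i j i = K.counit i) (x : X) : slice X τ ((K.expand X j).1 x) = x := by
  refine Eq.trans ?_ (K.slice_counit_coact X x)
  rw [expand_apply, slice_lTensor, hτ]

end

/-- The identity `Δ(p₁) τ(p₂ ⊗ q) = p₁ ⊗ p₂ τ(p₃ ⊗ q)`. -/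
theorem comul_slice {i j : ι} (τ : K.hom i j ⊗[k] K.hom j i →ₗ[k] k)
    (t : K.hom i j ⊗[k] K.hom j i) :
    K.comul i j i (slice (K.hom i i) τ (TensorProduct.assoc k _ _ _
      ((K.comul i i j).rTensor (K.hom j i) t))) =
    (slice (K.hom j i) τ ∘ₗ (TensorProduct.assoc k _ _ _).toLinearMap ∘ₗ
      (K.comul j i j).rTensor (K.hom j i)).lTensor (K.hom i j)
        (TensorProduct.assoc k _ _ _ ((K.comul i j j).rTensor (K.hom j i) t)) := by
  have h : ∀ (q : K.hom j i) (s : K.hom i j ⊗[k] K.hom j j),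
      (slice (K.hom j i) τ ∘ₗ (TensorProduct.assoc k _ _ _).toLinearMap ∘ₗ
        (K.comul j i j).rTensor (K.hom j i)).lTensor (K.hom i j)
          (TensorProduct.assoc k _ _ _ (s ⊗ₜ q)) =
      (slice (K.hom j i) (τ ∘ₗ (TensorProduct.mk k _ _).flip q)).lTensor (K.hom i j)
        ((K.comul j i j).lTensor (K.hom i j) s) := by
    intro q s
    induction s using TensorProduct.induction_on with
    | zero => simp
    | tmul p b => simp [slice_assoc_tmul]
    | add s t hs ht => simp only [add_tmul, map_add, hs, ht]
  induction t using TensorProduct.induction_on with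
  | zero => simp
  | tmul p q =>
    rw [LinearMap.rTensor_tmul, LinearMap.rTensor_tmul, slice_assoc_tmul, h, ← coassoc_apply,
      ← slice_assoc, slice_rTensor]
  | add s t hs ht => simp only [map_add, hs, ht]

section

variable {i j : ι} (X : Comod k (K.hom i i)) {τ : K.hom i j ⊗[k] K.hom j i →ₗ[k] k}

/-- The identity `q₁ τ(q₂ ⊗ q₃) = q` for `q` in `K.hom j i`, where the comultiplications pass
through `i` and then `j`, so that `q₂ ⊗ q₃` lies in `K.hom i j ⊗ K.hom j i`. -/
theorem slice_comul_comul (hτ : τ ∘ₗ K.comul i j i = K.counit i) :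
    (slice (K.hom j i) τ ∘ₗ (TensorProduct.assoc k _ _ _).toLinearMap ∘ₗ
      (K.comul j i j).rTensor (K.hom j i)) ∘ₗ K.comul j j i = LinearMap.id := by
  refine LinearMap.ext fun q => ?_
  simp only [LinearMap.comp_apply, LinearEquiv.coe_coe]
  rw [coassoc_apply, slice_lTensor, hτ, slice_counit]
  rfl

/-- On the iterated cotensor product, `1 ⊗ τ` is a right inverse of `(1 ⊗ Δ) ρ`: both cotensor
conditions are used to move the comultiplications to the last factor, where `τ Δ = ε`. -/
theorem expand_slice (hτ : τ ∘ₗ K.comul i j i = K.counit i)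
    (z : K.cotensor (K.cotensor X j) i) :
    (K.expand X j).1 (slice X τ ((K.incl₂ X j).1 z)) = (K.incl₂ X j).1 z := by
  have h1 : K.comul i j i ∘ₗ slice (K.hom i i) τ ∘ₗ (TensorProduct.assoc k _ _ _).toLinearMap ∘ₗ
      (K.comul i i j).rTensor (K.hom j i) =
      (slice (K.hom j i) τ ∘ₗ (TensorProduct.assoc k _ _ _).toLinearMap ∘ₗ
        (K.comul j i j).rTensor (K.hom j i)).lTensor (K.hom i j) ∘ₗ
          (TensorProduct.assoc k _ _ _).toLinearMap ∘ₗ (K.comul i j j).rTensor (K.hom j i) :=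
    LinearMap.ext (K.comul_slice τ)
  change (K.expand X j).1 (slice X τ (K.inclTensor X j (K.incl (K.cotensor X j) i z))) =
    K.inclTensor X j (K.incl (K.cotensor X j) i z)
  -- the cotensor condition over `K.hom j j`
  have h2 : ((TensorProduct.assoc k (K.hom i j) (K.hom j j) (K.hom j i)).toLinearMap ∘ₗ
      (K.comul i j j).rTensor (K.hom j i)).lTensor X
        (K.inclTensor X j (K.incl (K.cotensor X j) i z)) =
      ((K.comul j j i).lTensor (K.hom i j)).lTensor X
        (K.inclTensor X j (K.incl (K.cotensor X j) i z)) := by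
    rw [← assoc_incl_coact_rTensor, assoc_incl, assoc_incl_lTensor]
  -- the cotensor condition over `K.hom i i`
  have h3 : X.coact (slice X τ (K.inclTensor X j (K.incl (K.cotensor X j) i z))) =
      (slice (K.hom i i) τ ∘ₗ (TensorProduct.assoc k _ _ _).toLinearMap ∘ₗ
        (K.comul i i j).rTensor (K.hom j i)).lTensor X
          (K.inclTensor X j (K.incl (K.cotensor X j) i z)) := by
    rw [← slice_rTensor, slice_assoc, assoc_coact_inclTensor, ← LinearMap.lTensor_comp_apply]
  rw [expand_apply, h3, ← LinearMap.lTensor_comp_apply, h1, LinearMap.lTensor_comp_apply, h2,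
    ← LinearMap.lTensor_comp_apply, ← LinearMap.lTensor_comp, K.slice_comul_comul hτ,
    LinearMap.lTensor_id, LinearMap.lTensor_id]
  rfl

/-- The element `(1 ⊗ Δ) ρ x` lies in the iterated cotensor product. -/
theorem exists_incl₂ (x : X) : ∃ z, (K.incl₂ X j).1 z = (K.expand X j).1 x := by
  obtain ⟨w, hw⟩ : ∃ w, K.inclTensor X j w = (K.expand X j).1 x := by
    let t := (TensorProduct.assoc k X (K.hom i j) (K.hom j i)).symm ((K.expand X j).1 x)
    have ht : TensorProduct.assoc k X (K.hom i j) (K.hom j i) t = (K.expand X j).1 x :=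
      LinearEquiv.apply_symm_apply _ _
    have h1 : ((TensorProduct.assoc k X (K.hom i i) (K.hom i j)).toLinearMap ∘ₗ
        X.coact.rTensor (K.hom i j)).rTensor (K.hom j i) t =
        ((K.comul i i j).lTensor X).rTensor (K.hom j i) t := by
      refine (TensorProduct.assoc k X (K.hom i i ⊗[k] K.hom i j) (K.hom j i)).injective ?_
      refine (LinearEquiv.lTensor X
        (TensorProduct.assoc k (K.hom i i) (K.hom i j) (K.hom j i))).injective ?_
      refine (K.assoc_assoc_rTensor_coact X j t).trans ?_
      rw [ht, expand_apply, ← lTensor_rTensor_apply, assoc_lTensor, assoc_lTensor_rTensor, ht,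
        expand_apply]
      have h2 : TensorProduct.assoc k X (K.hom i i) (K.hom i i)
          (X.coact.rTensor (K.hom i i) (X.coact x)) = (K.comul i i i).lTensor X (X.coact x) :=
        LinearMap.congr_fun X.coassoc x
      rw [h2, ← LinearMap.lTensor_comp_apply, ← LinearMap.lTensor_comp_apply, ← K.coassoc i i j i,
        LinearMap.lTensor_comp_apply, LinearMap.lTensor_comp_apply]
      rfl
    obtain ⟨w, hw⟩ := exists_rTensor_kerι (K.cotensorMap X j) (t := t) (by
      change (((TensorProduct.assoc k X (K.hom i i) (K.hom i j)).toLinearMap ∘ₗ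
        X.coact.rTensor (K.hom i j)) - (K.comul i i j).lTensor X).rTensor (K.hom j i) t = 0
      rw [LinearMap.rTensor_sub, LinearMap.sub_apply]
      exact sub_eq_zero.2 h1)
    exact ⟨w, (congrArg _ hw).trans ht⟩
  obtain ⟨z, hz⟩ := K.exists_incl (K.cotensor X j) i (t := w) (by
    refine rTensor_injective (K.incl_injective X j) _ ?_
    refine (TensorProduct.assoc k X (K.hom i j) (K.hom j j ⊗[k] K.hom j i)).injective ?_
    rw [assoc_incl_coact_rTensor, assoc_incl_lTensor, hw, expand_apply,
      ← LinearMap.lTensor_comp_apply, ← LinearMap.lTensor_comp_apply, LinearMap.comp_assoc,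
      K.coassoc i j j i])
  exact ⟨z, by rw [incl₂_apply, hz, hw]⟩

/-- The isomorphism `(X □ K.hom i j) □ K.hom j i ≅ X` given by `1 ⊗ τ`. -/
noncomputable def cotensorCotensorIso (hτ : τ ∘ₗ K.comul i j i = K.counit i) :
    K.cotensor (K.cotensor X j) i ≅ X :=
  have hinj : Function.Injective (K.expand X j).1 := fun x y h => by
    rw [← K.slice_expand X hτ x, h, K.slice_expand X hτ y]
  isoOfBijective ⟨slice X τ ∘ₗ (K.incl₂ X j).1, mem_com_of_comp (K.expand X j) hinj (by
      have h : (K.expand X j).1 ∘ₗ slice X τ ∘ₗ (K.incl₂ X j).1 = (K.incl₂ X j).1 :=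
        LinearMap.ext (K.expand_slice X hτ)
      rw [h]
      exact (K.incl₂ X j).2)⟩
    ⟨fun y z h => K.incl₂_injective X j (by
      rw [← K.expand_slice X hτ y, ← K.expand_slice X hτ z]
      exact congrArg (K.expand X j).1 h),
    fun x => by
      obtain ⟨z, hz⟩ := K.exists_incl₂ (j := j) X x
      exact ⟨z, hinj ((K.expand_slice X hτ z).trans hz)⟩⟩

end

/-- The natural isomorphism `(X □ K.hom i j) □ K.hom j i ≅ X`. -/
noncomputable def cotensorFunctorCompIso {i j : ι} {τ : K.hom i j ⊗[k] K.hom j i →ₗ[k] k}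
    (hτ : τ ∘ₗ K.comul i j i = K.counit i) :
    K.cotensorFunctor i j ⋙ K.cotensorFunctor j i ≅ 𝟭 (Comod k (K.hom i i)) :=
  NatIso.ofComponents (fun X => K.cotensorCotensorIso X hτ) fun {X Y} u => hom_ext_apply
    fun (z : K.cotensor (K.cotensor X j) i) => by
    change slice Y τ ((K.incl₂ Y j).1 ((K.cotensorHom i (K.cotensorHom j u)).1 z)) =
      u.1 (slice X τ ((K.incl₂ X j).1 z))
    have h : K.incl Y j ∘ₗ (K.cotensorHom j u).1 = u.1.rTensor (K.hom i j) ∘ₗ K.incl X j := rfl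
    rw [incl₂_apply, incl_cotensorHom, inclTensor_apply, ← LinearMap.rTensor_comp_apply, h,
      LinearMap.rTensor_comp_apply, assoc_rTensor, slice_rTensor]
    rfl

/-- Cotensoring `K.hom i i` itself with `K.hom i j` gives `K.hom i j`. -/
noncomputable def rowIso (i j : ι) : K.row i j ≅ K.cotensor (K.row i i) j :=
  isoOfBijective (kerLift (K.cotensorMap (K.row i i) j) (K.rowComul i i j)
      fun x => sub_eq_zero.2 (K.coassoc_apply i i i j x))
    ⟨fun x y h => by
      have h1 : K.comul i i j x = K.comul i i j y := congrArg (K.incl (K.row i i) j) h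
      exact (K.lslice_counit i j x).symm.trans ((congrArg _ h1).trans (K.lslice_counit i j y)),
    fun z => by
      refine ⟨lslice (K.hom i j) (K.counit i) (K.incl (K.row i i) j z),
        K.incl_injective (K.row i i) j ?_⟩
      -- apply `ε ⊗ 1 ⊗ 1` to the cotensor condition
      have h : ∀ t : K.hom i i ⊗[k] K.hom i j,
          TensorProduct.assoc k (K.hom i i) (K.hom i i) (K.hom i j)
            ((K.comul i i i).rTensor (K.hom i j) t) = (K.comul i i j).lTensor (K.hom i i) t →
          K.comul i i j (lslice (K.hom i j) (K.counit i) t) = t := by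
        intro t ht
        have h1 : lslice (K.hom i i) (K.counit i) ∘ₗ K.comul i i i = LinearMap.id :=
          LinearMap.ext (K.lslice_counit i i)
        rw [← lslice_lTensor, ← ht, lslice_assoc, ← LinearMap.rTensor_comp_apply, h1,
          LinearMap.rTensor_id_apply]
      exact h _ (K.assoc_incl (K.row i i) j z)⟩

variable {K} in
/-- If `i` and `j` are retracts of finite sums of copies of each other, then cotensoring with
`K.hom i j` and with `K.hom j i` are mutually inverse strong equivalences. -/
theorem IsRetract.stronglyEquivalent {i j : ι} (hij : K.IsRetract i j) (hji : K.IsRetract j i) :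
    StronglyEquivalent k (K.hom i i) (K.hom j j) := by
  obtain ⟨τ, hτ⟩ := hij.exists_pairing
  obtain ⟨σ, hσ⟩ := hji.exists_pairing
  have key : ∀ {i j : ι}, K.IsRetract i j → K.IsRetract j i →
      IsIngenerator ((K.cotensorFunctor i j).obj (regular k (K.hom i i))) := by
    intro i j hij hji
    obtain ⟨m, P, e⟩ := ((hij.isSummand j).of_iso (K.rowIso i j)).exists_prod_iso
    obtain ⟨n, Q, f⟩ := ((hji.isSummand j).of_iso_right (K.rowIso i j)).exists_prod_iso
    exact ⟨m, n, P, Q, e, f⟩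
  exact ⟨CategoryTheory.Equivalence.mk (K.cotensorFunctor i j) (K.cotensorFunctor j i)
    (K.cotensorFunctorCompIso hτ).symm (K.cotensorFunctorCompIso hσ),
    inferInstanceAs (K.cotensorFunctor i j).Additive,
    inferInstanceAs ((K.cotensorFunctor i j).Linear k), key hij hji, key hji hij⟩

end Cocategory

/-! ### The cocategory of quasi-finite comodules -/

namespace Comod

section CohomCocategory

variable {k C : Type u} [Field k] [AddCommGroup C] [Module k C] [Coalgebra k C]

section

variable {M N L P : Comod k C}

/-- The comultiplication `h(L, M) → h(N, M) ⊗ h(L, N)` of co-hom spaces: the unique linear map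
`Δ` with `(Δ ⊗ 1) η = (1 ⊗ η) η`. -/
noncomputable def Cohom.split (H : Cohom L M) (H₁ : Cohom N M) (H₂ : Cohom L N) :
    H.carrier →ₗ[k] H₁.carrier ⊗[k] H₂.carrier :=
  (H.universal _ _ (H₁.isColinear.trans H₂.isColinear)).choose

theorem Cohom.split_apply (H : Cohom L M) (H₁ : Cohom N M) (H₂ : Cohom L N) (m : M) :
    (H.split H₁ H₂).rTensor L (H.η m) =
      (TensorProduct.assoc k H₁.carrier H₂.carrier L).symm (H₂.η.lTensor H₁.carrier (H₁.η m)) :=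
  LinearMap.congr_fun (H.universal _ _ (H₁.isColinear.trans H₂.isColinear)).choose_spec.1 m

/-- Coassociativity: both sides become `(1 ⊗ 1 ⊗ η) (1 ⊗ η) η` after composition with `η`. -/
theorem Cohom.split_coassoc (HMP : Cohom P M) (HML : Cohom L M) (HMN : Cohom N M)
    (HLP : Cohom P L) (HNP : Cohom P N) (HNL : Cohom L N) :
    (TensorProduct.assoc k HMN.carrier HNL.carrier HLP.carrier).toLinearMap ∘ₗ
      (HML.split HMN HNL).rTensor HLP.carrier ∘ₗ HMP.split HML HLP =
      (HNP.split HNL HLP).lTensor HMN.carrier ∘ₗ HMP.split HMN HNP := by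
  have h1 : ((TensorProduct.assoc k HMN.carrier HNL.carrier HLP.carrier).toLinearMap).rTensor P ∘ₗ
      (TensorProduct.assoc k (HMN.carrier ⊗[k] HNL.carrier) HLP.carrier P).symm.toLinearMap ∘ₗ
      HLP.η.lTensor (HMN.carrier ⊗[k] HNL.carrier) ∘ₗ
      (TensorProduct.assoc k HMN.carrier HNL.carrier L).symm.toLinearMap =
      (TensorProduct.assoc k HMN.carrier (HNL.carrier ⊗[k] HLP.carrier) P).symm.toLinearMap ∘ₗ
      ((TensorProduct.assoc k HNL.carrier HLP.carrier P).symm.toLinearMap ∘ₗ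
        HLP.η.lTensor HNL.carrier).lTensor HMN.carrier := by
    ext a b m
    simp only [TensorProduct.AlgebraTensorModule.curry_apply, LinearMap.restrictScalars_self,
      TensorProduct.curry_apply, LinearMap.comp_apply, LinearEquiv.coe_coe,
      LinearMap.lTensor_tmul, TensorProduct.assoc_symm_tmul]
    induction HLP.η m using TensorProduct.induction_on with
    | zero => simp
    | tmul w z => simp
    | add s t hs ht => simp only [tmul_add, map_add, hs, ht]
  refine HMP.hom_ext (LinearMap.ext fun m => ?_)
  have h2 := LinearMap.congr_fun h1 (HNL.η.lTensor HMN.carrier (HMN.η m))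
  simp only [LinearMap.comp_apply, LinearEquiv.coe_coe, LinearMap.rTensor_comp_apply,
    Cohom.split_apply, assoc_symm_rTensor, assoc_symm_lTensor] at h2 ⊢
  rw [← lTensor_rTensor_apply, Cohom.split_apply, h2, ← LinearMap.lTensor_comp_apply,
    ← LinearMap.lTensor_comp_apply]
  congr 2
  exact congrArg (LinearMap.lTensor HMN.carrier)
    (LinearMap.ext fun n => (HNP.split_apply HNL HLP n).symm)

/-- The functional on `h(N, M)` given by a comodule map `f : M → N`: the unique linear map `v`
with `(v ⊗ 1) η = f`. -/
noncomputable def Cohom.eval (H : Cohom N M) (f : M ⟶ N) : H.carrier →ₗ[k] k :=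
  (H.universal _ _ (isColinear_one f)).choose

theorem Cohom.eval_apply (H : Cohom N M) (f : M ⟶ N) (m : M) :
    (H.eval f).rTensor N (H.η m) = 1 ⊗ₜ[k] f.1 m :=
  LinearMap.congr_fun (H.universal _ _ (isColinear_one f)).choose_spec.1 m

theorem Cohom.lslice_eval (H : Cohom N M) (f : M ⟶ N) (m : M) :
    lslice N (H.eval f) (H.η m) = f.1 m := by
  simp [lslice, H.eval_apply]

theorem Cohom.eval_sum (H : Cohom N M) {n : ℕ} (f : Fin n → (M ⟶ N)) :
    ∑ a, H.eval (f a) = H.eval (∑ a, f a) := by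
  refine H.hom_ext (LinearMap.ext fun m => ?_)
  have h1 : (∑ a, H.eval (f a)).rTensor N = ∑ a, (H.eval (f a)).rTensor N :=
    map_sum (LinearMap.rTensorHom N) _ _
  rw [h1, LinearMap.comp_apply, LinearMap.comp_apply, LinearMap.sum_apply, H.eval_apply,
    hom_sum_apply, tmul_sum]
  exact Finset.sum_congr rfl fun a _ => H.eval_apply (f a) m

theorem Cohom.eval_comp (H : Cohom L M) (H₁ : Cohom N M) (H₂ : Cohom L N) (f : M ⟶ N)
    (g : N ⟶ L) : H₂.eval g ∘ₗ lslice H₂.carrier (H₁.eval f) ∘ₗ H.split H₁ H₂ =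
      H.eval (f ≫ g) := by
  refine H.hom_ext (LinearMap.ext fun m => ?_)
  simp only [LinearMap.comp_apply, LinearMap.rTensor_comp_apply]
  rw [H.split_apply, ← lslice_assoc, LinearEquiv.apply_symm_apply, lslice_lTensor, H₁.lslice_eval,
    H₂.eval_apply, H.eval_apply]
  rfl

/-- The functional `ev 1` on `h(M, M)` is a left counit for the comultiplications. -/
theorem Cohom.rTensor_eval_split (H : Cohom L M) (H₁ : Cohom M M) :
    (H₁.eval (𝟙 M)).rTensor H.carrier ∘ₗ H.split H₁ H = TensorProduct.mk k k H.carrier 1 := by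
  refine H.hom_ext (LinearMap.ext fun m => ?_)
  simp only [LinearMap.comp_apply, LinearMap.rTensor_comp_apply, H.split_apply,
    assoc_symm_rTensor]
  rw [← lTensor_rTensor_apply, H₁.eval_apply, LinearMap.lTensor_tmul]
  change (TensorProduct.assoc k k H.carrier L).symm (1 ⊗ₜ H.η m) = _
  induction H.η m using TensorProduct.induction_on with
  | zero => simp
  | tmul w z => simp
  | add s t hs ht => simp only [tmul_add, map_add, hs, ht]

/-- The functional `ev 1` on `h(L, L)` is a right counit for the comultiplications. -/
theorem Cohom.lTensor_eval_split (H : Cohom L M) (H₂ : Cohom L L) :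
    (H₂.eval (𝟙 L)).lTensor H.carrier ∘ₗ H.split H H₂ =
      (TensorProduct.mk k H.carrier k).flip 1 := by
  refine H.hom_ext (LinearMap.ext fun m => ?_)
  simp only [LinearMap.comp_apply, LinearMap.rTensor_comp_apply, H.split_apply,
    assoc_symm_lTensor]
  have h : (H₂.eval (𝟙 L)).rTensor L ∘ₗ H₂.η = TensorProduct.mk k k L 1 :=
    LinearMap.ext (H₂.eval_apply (𝟙 L))
  rw [← LinearMap.lTensor_comp_apply, h]
  exact LinearMap.congr_fun (f := (TensorProduct.assoc k H.carrier k L).symm.toLinearMap ∘ₗ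
    (TensorProduct.mk k k L 1).lTensor H.carrier)
    (g := ((TensorProduct.mk k H.carrier k).flip 1).rTensor L) (by ext; simp) _

end

variable (k C) in
/-- The cocategory of quasi-finite comodules: its spaces are the co-hom spaces, with
`hom M N = h(N, M)`, and its coendomorphism coalgebras are the `e(M) = h(M, M)`. -/
noncomputable def cohomCocategory : Cocategory k {M : Comod k C // M.QuasiFinite} where
  hom M N := (cohom N.2 M.1).carrier
  comul M N L := (cohom L.2 M.1).split (cohom N.2 M.1) (cohom L.2 N.1)
  counit M := (cohom M.2 M.1).eval (𝟙 M.1)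
  coassoc _ _ _ _ := Cohom.split_coassoc _ _ _ _ _ _
  rTensor_counit _ _ := Cohom.rTensor_eval_split _ _
  lTensor_counit _ _ := Cohom.lTensor_eval_split _ _

/-- A decomposition `∑ s_a ≫ r_a = 1` of the identity of `M` becomes a decomposition of the counit
of its coendomorphism coalgebra. -/
theorem IsSummand.isRetract {M N : Comod k C} (h : IsSummand M N) (hM : M.QuasiFinite)
    (hN : N.QuasiFinite) : (cohomCocategory k C).IsRetract ⟨M, hM⟩ ⟨N, hN⟩ := by
  obtain ⟨n, s, r, h⟩ := h
  refine ⟨n, fun a => (cohom hN M).eval (s a), fun a => (cohom hM N).eval (r a), ?_⟩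
  have h1 : ∀ a, (cohomCocategory k C).convol (i := ⟨M, hM⟩) (j := ⟨N, hN⟩) (l := ⟨M, hM⟩)
      ((cohom hN M).eval (s a)) ((cohom hM N).eval (r a)) = (cohom hM M).eval (s a ≫ r a) :=
    fun a => Cohom.eval_comp _ _ _ _ _
  refine (Finset.sum_congr rfl fun a _ => h1 a).trans ?_
  refine ((cohom hM M).eval_sum fun a => s a ≫ r a).trans ?_
  rw [h]
  rfl

end CohomCocategory

end Comod

theorem theorem2p3 {k C : Type u} [Field k] [AddCommGroup C] [Module k C] [Coalgebra k C]
    (M N : Comod k C) (hM : M.QuasiFinite) (hN : N.QuasiFinite) (h : Comod.Similar M N) :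
    Comod.StronglyEquivalent k (Comod.Coend hM) (Comod.Coend hN) := by
  obtain ⟨m, n, P, Q, ⟨e⟩, ⟨f⟩⟩ := h
  exact ((Comod.IsSummand.of_prod_iso e).isRetract hM hN).stronglyEquivalent
    ((Comod.IsSummand.of_prod_iso f).isRetract hN hM)
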